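/- Let $(\alpha_n)_{n\ge 0}$ be a sequence of non-zero real numbers with $\sup_n|\alpha_n|<\infty$, and consider the non-terminating C-fraction $$\varphi(z)=\cfrac{\alpha_0}{1-\cfrac{\alpha_1 z}{1-\cfrac{\alpha_2 z}{1-\ddots}}}.$$ Notation. Let $\mathbb C_+=\{z\in\mathbb C:\operatorname{Im}z>0\}$. For $\kappa\in\{0,1,2,\dots\}$, the class $\mathcal N_\kappa$ consists of the functions $f$ meromorphic in $\mathbb C_+$ such that, for every finite family $z_1,\dots,z_n\in\mathbb C_+$ of points at which $f$ is holomorphic, the Hermitian matrix $\Big[\frac{f(z_k)-\overline{f(z_j)}}{z_k-\overline{z_j}}\Big]_{k,j=1}^n$ has at most $\kappa$ negative eigenvalues (counted with multiplicity), and for some such family it has exactly $\kappa$ negative eigenvalues. We write $f\in\mathcal N_\kappa^\lambda$ if $f\in\mathcal N_\kappa$ and the function $z\mapsto zf(z)$ is in $\mathcal N_\lambda$. The C-fraction converges uniformly in a neighbourhood of $0$ to an analytic function, which is also denoted by $\varphi$. For a real constant $\varepsilon$, we say that $\varepsilon\varphi$ belongs to one of these classes if it extends from the intersection of $\mathbb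 C_+$ with some neighbourhood of $0$ to a meromorphic function on $\mathbb C_+$ belonging to that class. (1) Suppose that there is an integer $m\ge 1$ such that $\alpha_n>0$ for all $n>2m$. Put $$\varepsilon_j=\operatorname{sign}\prod_{k=j}^{2m}\alpha_k=\prod_{k=j}^{\infty}\operatorname{sign}\alpha_k ,$$ let $\lambda$ be the number of negative entries in the sequence $\varepsilon_1,\varepsilon_3,\dots,\varepsilon_{2m-1}$ and $\kappa$ the number of negative entries in the sequence $\varepsilon_2,\varepsilon_4,\dots,\varepsilon_{2m}$. Then $\varepsilon_0\varphi\in\mathcal N_\kappa^\lambda$ and $-\varepsilon_0\varphi\notin\bigcup_{\kappa'\ge 0}\mathcal N_{\kappa'}$. (2) Conversely, $\varepsilon\varphi\notin\bigcup_{\kappa',\lambda'\ge 0}\mathcal N_{\kappa'}^{\lambda'}$ for both $\varepsilon\in\{-1,1\}$ if and only if $\alpha_n<0$ for infinitely many $n$. -/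

import Mathlib

open Filter Topology

/-- The Pick matrix `[(f (z k) - conj (f (z j))) / (z k - conj (z j))]` of `f` at the points
`z 0, …, z (n - 1)`. -/
noncomputable def pickMatrix (f : ℂ → ℂ) {n : ℕ} (z : Fin n → ℂ) : Matrix (Fin n) (Fin n) ℂ :=
  Matrix.of fun k j =>
    (f (z k) - (starRingEnd ℂ) (f (z j))) / (z k - (starRingEnd ℂ) (z j))

theorem pickMatrix_isHermitian (f : ℂ → ℂ) {n : ℕ} (z : Fin n → ℂ) :
    (pickMatrix f z).IsHermitian := by
  ext k j
  simp only [pickMatrix, Matrix.conjTranspose_apply, Matrix.of_apply, RCLike.star_def, map_div₀,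
    map_sub, RingHomCompTriple.comp_apply, RingHom.id_apply]
  rw [← neg_sub (f (z k)), ← neg_sub (z k), neg_div_neg_eq]

/-- The number of negative squares of the Hermitian form given by the Pick matrix, i.e. the number
of negative eigenvalues of that matrix, counted with multiplicity. -/
noncomputable def pickNegSquares (f : ℂ → ℂ) {n : ℕ} (z : Fin n → ℂ) : ℕ :=
  (Finset.univ.filter fun i => (pickMatrix_isHermitian f z).eigenvalues i < 0).card

/-- `z` is a finite family of points of the open upper half-plane at which `f` is holomorphic (so
that no point is a pole, and `f (z k)` is the actual value of the meromorphic function there). -/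
def PickAdmissible (f : ℂ → ℂ) {n : ℕ} (z : Fin n → ℂ) : Prop :=
  ∀ k, 0 < (z k).im ∧ AnalyticAt ℂ f (z k)

/-- The generalized Nevanlinna class `N_κ`: functions meromorphic in the open upper half-plane
whose Pick matrices have at most `κ` negative eigenvalues, the number `κ` being attained. -/
def genNevanlinna (κ : ℕ) : Set (ℂ → ℂ) :=
  {f | MeromorphicOn f {z : ℂ | 0 < z.im} ∧
    (∀ (n : ℕ) (z : Fin n → ℂ), PickAdmissible f z → pickNegSquares f z ≤ κ) ∧
    ∃ (n : ℕ) (z : Fin n → ℂ), PickAdmissible f z ∧ pickNegSquares f z = κ}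

/-- The class `N_κ^l`: `f ∈ N_κ` and `z f(z) ∈ N_l`. -/
def genStieltjes (κ l : ℕ) : Set (ℂ → ℂ) :=
  {f | f ∈ genNevanlinna κ ∧ (fun z => z * f z) ∈ genNevanlinna l}

/-- The union of all classes `N_κ`. -/
def genNevanlinnaUnion : Set (ℂ → ℂ) := ⋃ κ : ℕ, genNevanlinna κ

/-- The union of all classes `N_κ^l`. -/
def genStieltjesUnion : Set (ℂ → ℂ) := ⋃ κ : ℕ, ⋃ l : ℕ, genStieltjes κ l

/-- `cfracApprox α N n z` is the finite continued fraction
`α n / (1 - α (n+1) z / (1 - ⋯ / (1 - α (n+N) z)))`. -/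
noncomputable def cfracApprox (α : ℕ → ℝ) : ℕ → ℕ → ℂ → ℂ
  | 0, n, _ => (α n : ℂ)
  | N + 1, n, z => (α n : ℂ) / (1 - z * cfracApprox α N (n + 1) z)

/-- The value at `z` of the C-fraction `α 0 / (1 - α 1 z / (1 - α 2 z / (1 - ⋯)))`; it is used only
for `z` near `0`. -/
noncomputable def cfrac (α : ℕ → ℝ) (z : ℂ) : ℂ :=
  limUnder atTop fun N => cfracApprox α N 0 z

/-- The germ at `0` of `φ`, restricted to the upper half-plane, extends to a function on the
upper half-plane that belongs to the class `S`. -/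
def ContinuesInto (S : Set (ℂ → ℂ)) (φ : ℂ → ℂ) : Prop :=
  ∃ F ∈ S, ∀ᶠ z in 𝓝[{z : ℂ | 0 < z.im}] 0, F z = φ z

/-- `ε_j = sign (α j * α (j+1) * ⋯ * α (2m))`. -/
noncomputable def cfracSign (α : ℕ → ℝ) (m j : ℕ) : ℝ :=
  Real.sign (∏ k ∈ Finset.Icc j (2 * m), α k)

/-- The number of negative entries among `ε_2, ε_4, …, ε_{2m}`. -/
noncomputable def cfracKappa (α : ℕ → ℝ) (m : ℕ) : ℕ :=
  ((Finset.range m).filter fun i => cfracSign α m (2 * i + 2) < 0).card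

/-- The number of negative entries among `ε_1, ε_3, …, ε_{2m-1}`. -/
noncomputable def cfracLambda (α : ℕ → ℝ) (m : ℕ) : ℕ :=
  ((Finset.range m).filter fun i => cfracSign α m (2 * i + 1) < 0).card

/-! The tails `φ_j` of the fraction satisfy `φ_j (1 - z φ_{j+1}) = α_j`. With `e' = e α_j`, this
identity turns the Pick kernel of `e φ_j` into that of `z e' φ_{j+1}`, and the Pick kernel of `z e
φ_j` into the constant `e'` plus `z_k K(z_k, z_j) conj z_j`, where `K` is the kernel of `e'
φ_{j+1}`; both hold up to a diagonal congruence (`pickMatrix_step`, `pickMatrix_id_mul_step`). So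
one step swaps the two functions, and the index of `z e φ_j` gains one negative square exactly when
`e' < 0`. Starting from `ε`, the multipliers are `e_n = ε α_0 ⋯ α_{n-1}`; the negative `e_2, e_4, …`
are charged to `φ` and the negative `e_1, e_3, …` to `z φ`.

Upper and lower bounds are proved separately. Lower bounds (`PickNegNearZero`) use only points near
`0`, where everything converges, and need no positivity. The constant `e'` really contributes its
square: adjoin a point `iy` and let `y → 0`, so that its row and column retain only `e'`. If
infinitely many `e_n` of one parity are negative, the corresponding function is therefore in no
class `N_κ`.

Upper bounds (`HasPickExtension`) need eventually positive coefficients. The approximants of a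
positive tail have positive Pick kernels and are locally bounded in the upper half-plane, so a limit
extends the tail with index `0`. Finitely many steps backwards give a quotient `P / Q` whose indices
grow by at most the counted signs.

For `ε = ε_0`, the sign of `e_n` is `ε_n`, and the two bounds meet at `κ` and `λ`. For `-ε_0`, the
`e_n` are eventually negative. If `α_n < 0` infinitely often, the `e_n` change sign infinitely often
for either `ε`. -/

/-! ### Negative index of Hermitian matrices: lower and upper certificates. -/

/-- The Hermitian form `∑ conj (x i) M i j x j` of a matrix. -/
def hermForm {ι : Type*} [Fintype ι] (M : Matrix ι ι ℂ) (x : ι → ℂ) : ℂ :=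
  ∑ i, ∑ j, star (x i) * M i j * x j

theorem continuous_hermForm_linearMap {ι : Type*} [Fintype ι] {k : ℕ}
    (L : (Fin k → ℂ) →ₗ[ℂ] (ι → ℂ)) :
    Continuous fun p : Matrix ι ι ℂ × (Fin k → ℂ) => hermForm p.1 (L p.2) := by
  have hLc : Continuous L := L.continuous_of_finiteDimensional
  have h1 : ∀ i, Continuous fun p : Matrix ι ι ℂ × (Fin k → ℂ) => L p.2 i := fun i =>
    (continuous_apply i).comp (hLc.comp continuous_snd)
  have h2 : ∀ i j, Continuous fun p : Matrix ι ι ℂ × (Fin k → ℂ) => p.1 i j := fun i j =>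
    (continuous_apply_apply i j).comp continuous_fst
  exact continuous_finsetSum _ fun i _ => continuous_finsetSum _
    fun j _ => ((h1 i).star.mul (h2 i j)).mul (h1 j)

theorem continuous_re_hermForm_linearMap {ι : Type*} [Fintype ι] {k : ℕ}
    (L : (Fin k → ℂ) →ₗ[ℂ] (ι → ℂ)) :
    Continuous fun p : Matrix ι ι ℂ × (Fin k → ℂ) => (hermForm p.1 (L p.2)).re := by
  exact Complex.continuous_re.comp (continuous_hermForm_linearMap L)

theorem isOpen_setOf_hermForm_neg {ι : Type*} [Fintype ι] {k : ℕ}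
    (L : (Fin k → ℂ) →ₗ[ℂ] (ι → ℂ)) :
    IsOpen {p : Matrix ι ι ℂ × (Fin k → ℂ) | (hermForm p.1 (L p.2)).re < 0} := by
  exact isOpen_lt (continuous_re_hermForm_linearMap L) continuous_const

section

open Matrix
open scoped ComplexOrder

theorem hermForm_eq_dotProduct {ι : Type*} [Fintype ι] (M : Matrix ι ι ℂ) (x : ι → ℂ) :
    hermForm M x = star x ⬝ᵥ (M *ᵥ x) := by
  simp [hermForm, dotProduct, mulVec, Finset.mul_sum, mul_assoc]

/-- The Hermitian form of `M` is negative definite on the image of some injective linear map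
from a `k`-dimensional space. -/
def NegDefOnDim {ι : Type*} [Fintype ι] (M : Matrix ι ι ℂ) (k : ℕ) : Prop :=
  ∃ L : (Fin k → ℂ) →ₗ[ℂ] (ι → ℂ), ∀ c, c ≠ 0 → (hermForm M (L c)).re < 0

/-- `M` becomes positive semidefinite after adding a Gram matrix of rank at most `c`. -/
def NegRankLE {ι : Type*} [Fintype ι] (M : Matrix ι ι ℂ) (c : ℕ) : Prop :=
  ∃ U : Matrix ι (Fin c) ℂ, (M + U * Uᴴ).PosSemidef

theorem negRankLE_of_fintype {ι κ : Type*} [Fintype ι] [Fintype κ] {M : Matrix ι ι ℂ}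
    (U : Matrix ι κ ℂ) (hU : (M + U * Uᴴ).PosSemidef) : NegRankLE M (Fintype.card κ) := by
  refine ⟨U.submatrix id (Fintype.equivFin κ).symm, ?_⟩
  rw [conjTranspose_submatrix, submatrix_mul_equiv]
  simpa using hU

/-- If `k > c`, then `Uᴴ ∘ L` has a nonzero kernel vector. There the Gram term vanishes, so the form
would be both negative and nonnegative. -/
theorem NegDefOnDim.le {ι : Type*} [Fintype ι] {M : Matrix ι ι ℂ} {k c : ℕ}
    (h : NegDefOnDim M k) (h' : NegRankLE M c) : k ≤ c := by
  obtain ⟨L, hL⟩ := h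
  obtain ⟨U, hU⟩ := h'
  by_contra! hck
  have hker : LinearMap.ker (Uᴴ.mulVecLin ∘ₗ L) ≠ ⊥ :=
    LinearMap.ker_ne_bot_of_finrank_lt (by simpa using hck)
  obtain ⟨x, hx, hx0⟩ := (Submodule.ne_bot_iff _).1 hker
  have hx' : Uᴴ *ᵥ (L x) = 0 := by simpa using hx
  have h1 := hL x hx0
  have h2 := hU.dotProduct_mulVec_nonneg (L x)
  rw [add_mulVec, ← mulVec_mulVec, hx', mulVec_zero, add_zero, ← hermForm_eq_dotProduct] at h2
  exact absurd (Complex.le_def.1 h2).1 (by simpa using h1)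

theorem Matrix.IsHermitian.entry_eq_sum {ι : Type*} [Fintype ι] [DecidableEq ι] {M : Matrix ι ι ℂ}
    (hM : M.IsHermitian) (i j : ι) :
    M i j = ∑ k, (hM.eigenvectorUnitary : Matrix ι ι ℂ) i k * (hM.eigenvalues k : ℂ) *
      star ((hM.eigenvectorUnitary : Matrix ι ι ℂ) j k) := by
  conv_lhs => rw [hM.spectral_theorem, Unitary.conjStarAlgAut_apply]
  simp [Matrix.mul_apply, Matrix.diagonal_apply]

/-- Adding `|λ| v v*` for every negative eigenvalue `λ` leaves the positive part of `M`. Together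
with `Matrix.IsHermitian.negDefOnDim` and `NegDefOnDim.le`, this lets eigenvalue counts be estimated
without computing eigenvalues. -/
theorem Matrix.IsHermitian.negRankLE {ι : Type*} [Fintype ι] [DecidableEq ι] {M : Matrix ι ι ℂ}
    (hM : M.IsHermitian) :
    NegRankLE M (Finset.univ.filter fun i => hM.eigenvalues i < 0).card := by
  rw [← Fintype.card_subtype]
  set V : Matrix ι ι ℂ := (hM.eigenvectorUnitary : Matrix ι ι ℂ) with hV
  refine negRankLE_of_fintype
    (Matrix.of fun i (j : {j // hM.eigenvalues j < 0}) =>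
      V i j * (Real.sqrt (-hM.eigenvalues j) : ℂ)) ?_
  have key : M + (Matrix.of fun i (j : {j // hM.eigenvalues j < 0}) =>
      V i j * (Real.sqrt (-hM.eigenvalues j) : ℂ)) * (Matrix.of fun i
        (j : {j // hM.eigenvalues j < 0}) => V i j * (Real.sqrt (-hM.eigenvalues j) : ℂ))ᴴ =
      V * diagonal (fun k => ((max (hM.eigenvalues k) 0 : ℝ) : ℂ)) * Vᴴ := by
    ext i j
    rw [Matrix.add_apply, hM.entry_eq_sum i j]
    simp only [Matrix.mul_apply, Matrix.conjTranspose_apply, Matrix.of_apply,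
      Matrix.diagonal_apply, mul_ite, mul_zero, Finset.sum_ite_eq', Finset.mem_univ, if_true]
    rw [← Finset.sum_subtype (Finset.univ.filter fun k => hM.eigenvalues k < 0) (by simp)
      (fun k => V i k * (Real.sqrt (-hM.eigenvalues k) : ℂ) *
        star (V j k * (Real.sqrt (-hM.eigenvalues k) : ℂ))), Finset.sum_filter,
      ← Finset.sum_add_distrib]
    refine Finset.sum_congr rfl fun k _ => ?_
    rw [← hV]
    split_ifs with hk
    · have : (Real.sqrt (-hM.eigenvalues k) : ℂ) * (Real.sqrt (-hM.eigenvalues k) : ℂ) =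
          -hM.eigenvalues k := by
        rw [← Complex.ofReal_mul, Real.mul_self_sqrt (by linarith)]; simp
      rw [max_eq_right hk.le, star_mul', RCLike.star_def, Complex.conj_ofReal, Complex.ofReal_zero]
      linear_combination (V i k * (starRingEnd ℂ) (V j k)) * this
    · rw [max_eq_left (not_lt.1 hk), add_zero]
  rw [key]
  refine PosSemidef.mul_mul_conjTranspose_same (PosSemidef.diagonal fun k => ?_) V
  exact Complex.zero_le_real.2 (le_max_right _ _)

/-- The subspace is the span of the eigenvectors with negative eigenvalue, on which the form is
diagonal. -/
theorem Matrix.IsHermitian.negDefOnDim {ι : Type*} [Fintype ι] [DecidableEq ι] {M : Matrix ι ι ℂ}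
    (hM : M.IsHermitian) :
    NegDefOnDim M (Finset.univ.filter fun i => hM.eigenvalues i < 0).card := by
  rw [← Fintype.card_subtype]
  set V : Matrix ι ι ℂ := (hM.eigenvectorUnitary : Matrix ι ι ℂ) with hV
  let e := (Fintype.equivFin {i // hM.eigenvalues i < 0}).symm
  have hVV : Vᴴ * V = 1 := Unitary.coe_star_mul_self hM.eigenvectorUnitary
  have hdiag : Vᴴ * M * V = diagonal fun k => (hM.eigenvalues k : ℂ) := by
    have : M = V * (diagonal fun k => (hM.eigenvalues k : ℂ)) * Vᴴ := by
      conv_lhs => rw [hM.spectral_theorem, Unitary.conjStarAlgAut_apply]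
      rfl
    calc Vᴴ * M * V = Vᴴ * (V * (diagonal fun k => (hM.eigenvalues k : ℂ)) * Vᴴ) * V :=
          congrArg (fun A => Vᴴ * A * V) this
      _ = (Vᴴ * V) * (diagonal fun k => (hM.eigenvalues k : ℂ)) * (Vᴴ * V) := by
          simp only [Matrix.mul_assoc]
      _ = _ := by rw [hVV, Matrix.one_mul, Matrix.mul_one]
  refine ⟨(V.submatrix id fun j => (e j : ι)).mulVecLin, fun c hc => ?_⟩
  have hW : (V.submatrix id fun j => (e j : ι))ᴴ * M * (V.submatrix id fun j => (e j : ι)) =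
      diagonal fun j => (hM.eigenvalues (e j) : ℂ) := by
    ext i j
    have := congrFun (congrFun hdiag (e i)) (e j)
    have hij : ((e i : ι) = e j) ↔ i = j := Subtype.ext_iff.symm.trans e.apply_eq_iff_eq
    simp only [Matrix.mul_apply, diagonal_apply, hij] at this ⊢
    exact this
  have hform : hermForm M ((V.submatrix id fun j => (e j : ι)) *ᵥ c) =
      ∑ j, ((hM.eigenvalues (e j) * ‖c j‖ ^ 2 : ℝ) : ℂ) := by
    rw [hermForm_eq_dotProduct, star_mulVec, mulVec_mulVec, ← dotProduct_mulVec, mulVec_mulVec,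
      ← Matrix.mul_assoc, hW, dotProduct]
    refine Finset.sum_congr rfl fun j _ => ?_
    rw [mulVec_diagonal]
    have := Complex.conj_mul' (c j)
    simp only [Pi.star_apply, RCLike.star_def]
    push_cast
    linear_combination (hM.eigenvalues (e j) : ℂ) * this
  rw [mulVecLin_apply, hform, ← Complex.ofReal_sum, Complex.ofReal_re]
  obtain ⟨j, hj⟩ := Function.ne_iff.1 hc
  refine Finset.sum_neg' (fun i _ => ?_) ⟨j, Finset.mem_univ _, ?_⟩
  · exact mul_nonpos_of_nonpos_of_nonneg (e i).2.le (by positivity)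
  · have : 0 < ‖c j‖ := norm_pos_iff.2 hj
    exact mul_neg_of_neg_of_pos (e j).2 (by positivity)

theorem NegDefOnDim.congr_diagonal {ι : Type*} [Fintype ι] {M M' : Matrix ι ι ℂ} {k : ℕ}
    (h : NegDefOnDim M' k) (u : ι → ℂ) (hu : ∀ i, u i ≠ 0)
    (hM : ∀ i j, M i j = u i * M' i j * star (u j)) : NegDefOnDim M k := by
  obtain ⟨L, hL⟩ := h
  refine ⟨LinearMap.pi fun i => (star (u i))⁻¹ • LinearMap.proj i ∘ₗ L, fun c hc => ?_⟩
  convert! hL c hc using 2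
  refine Finset.sum_congr rfl fun i _ => Finset.sum_congr rfl fun j _ => ?_
  have hi := hu i
  have hj : star (u j) ≠ 0 := star_ne_zero.2 (hu j)
  simp only [LinearMap.pi_apply, LinearMap.smul_apply, LinearMap.comp_apply, LinearMap.proj_apply,
    smul_eq_mul, star_mul', star_inv₀, star_star, hM]
  field_simp

theorem NegRankLE.congr_diagonal {ι : Type*} [Fintype ι] [DecidableEq ι] {M M' : Matrix ι ι ℂ}
    {c : ℕ} (h : NegRankLE M' c) (u : ι → ℂ)
    (hM : ∀ i j, M i j = u i * M' i j * star (u j)) : NegRankLE M c := by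
  obtain ⟨U, hU⟩ := h
  refine ⟨diagonal u * U, ?_⟩
  have : M + diagonal u * U * (diagonal u * U)ᴴ =
      diagonal u * (M' + U * Uᴴ) * (diagonal u)ᴴ := by
    have : M = diagonal u * M' * (diagonal u)ᴴ := by
      ext i j; rw [diagonal_conjTranspose, mul_diagonal, diagonal_mul, hM i j]; rfl
    rw [this, conjTranspose_mul]
    simp only [Matrix.mul_add, Matrix.add_mul, Matrix.mul_assoc]
  rw [this]
  exact hU.mul_mul_conjTranspose_same _

/-- The constant matrix `e` has rank one: for `e < 0` a single extra column `√(-e)` cancels it, and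
otherwise it is itself positive semidefinite. -/
theorem NegRankLE.const_add {ι : Type*} [Fintype ι] [DecidableEq ι] {M M' : Matrix ι ι ℂ}
    {c : ℕ} (h : NegRankLE M' c) (u : ι → ℂ) {e : ℝ}
    (hM : ∀ i j, M i j = e + u i * M' i j * star (u j)) :
    NegRankLE M (c + if e < 0 then 1 else 0) := by
  obtain ⟨U, hU⟩ := h.congr_diagonal (M := Matrix.of fun i j => u i * M' i j * star (u j)) u
    (fun i j => rfl)
  split_ifs with he
  · have := negRankLE_of_fintype (M := M) (Matrix.fromCols U
      (Matrix.of fun _ (_ : Unit) => (Real.sqrt (-e) : ℂ))) ?_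
    · simpa using this
    · convert! hU using 1
      ext i j
      simp only [Matrix.add_apply, hM, Matrix.mul_apply, Fintype.sum_sum_type,
        Matrix.conjTranspose_apply, Matrix.fromCols_apply_inl, Matrix.fromCols_apply_inr,
        Matrix.of_apply]
      have : (Real.sqrt (-e) : ℂ) * (Real.sqrt (-e) : ℂ) = -e := by
        rw [← Complex.ofReal_mul, Real.mul_self_sqrt (by linarith)]; simp
      simp only [Finset.univ_unique, Finset.sum_singleton, RCLike.star_def,
        Complex.conj_ofReal, this]
      ring
  · refine ⟨U, ?_⟩
    have hv : (vecMulVec (fun _ : ι => (Real.sqrt e : ℂ))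
        (star fun _ : ι => (Real.sqrt e : ℂ))).PosSemidef :=
      posSemidef_vecMulVec_self_star _
    convert! hv.add hU using 1
    ext i j
    have : (Real.sqrt e : ℂ) * (Real.sqrt e : ℂ) = e := by
      rw [← Complex.ofReal_mul, Real.mul_self_sqrt (by linarith)]
    simp only [Matrix.add_apply, hM, vecMulVec_apply, Matrix.of_apply, Pi.star_apply,
      RCLike.star_def, Complex.conj_ofReal, this]
    ring

theorem hermForm_smul {ι : Type*} [Fintype ι] (M : Matrix ι ι ℂ) (t : ℝ) (x : ι → ℂ) :
    hermForm M ((t : ℂ) • x) = ((t ^ 2 : ℝ) : ℂ) * hermForm M x := by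
  simp only [hermForm, Finset.mul_sum]
  refine Finset.sum_congr rfl fun i _ => Finset.sum_congr rfl fun j _ => ?_
  simp
  ring

theorem hermForm_neg_of_smul {ι : Type*} [Fintype ι] {M : Matrix ι ι ℂ} {t : ℝ} {x : ι → ℂ}
    (h : (hermForm M ((t : ℂ) • x)).re < 0) : (hermForm M x).re < 0 := by
  rw [hermForm_smul, Complex.re_ofReal_mul] at h
  exact neg_of_mul_neg_right h (sq_nonneg _)

/-- The negative index is lower semicontinuous: by compactness of the unit sphere and the tube
lemma, the same `L` works for all nearby matrices, and homogeneity removes the normalisation. -/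
theorem NegDefOnDim.eventually {ι β : Type*} [Fintype ι] {M₀ : Matrix ι ι ℂ} {k : ℕ}
    (h : NegDefOnDim M₀ k) {l : Filter β} {M : β → Matrix ι ι ℂ} (hM : Tendsto M l (𝓝 M₀)) :
    ∀ᶠ t in l, NegDefOnDim (M t) k := by
  obtain ⟨L, hL⟩ := h
  have hopen := isOpen_setOf_hermForm_neg L
  have hsub : ({M₀} : Set (Matrix ι ι ℂ)) ×ˢ Metric.sphere (0 : Fin k → ℂ) 1 ⊆
      {p : Matrix ι ι ℂ × (Fin k → ℂ) | (hermForm p.1 (L p.2)).re < 0} := by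
    intro p hp
    have h1 : p.1 = M₀ := hp.1
    have h2 : p.2 ≠ 0 := by
      intro h0
      have := hp.2
      rw [h0] at this
      simp at this
    rw [Set.mem_ofPred_eq, h1]
    exact hL _ h2
  obtain ⟨u, v, hu, -, hMu, hSv, huv⟩ := generalized_tube_lemma
    isCompact_singleton (isCompact_sphere (0 : Fin k → ℂ) 1) hopen hsub
  filter_upwards [hM (hu.mem_nhds (hMu rfl))] with t ht
  refine ⟨L, fun c hc => ?_⟩
  have hc' : 0 < ‖c‖ := norm_pos_iff.2 hc
  have hmem : ((‖c‖⁻¹ : ℝ) : ℂ) • c ∈ Metric.sphere (0 : Fin k → ℂ) 1 := by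
    rw [mem_sphere_zero_iff_norm, norm_smul, Complex.norm_real, norm_inv, norm_norm,
      inv_mul_cancel₀ hc'.ne']
  have h1 := huv (Set.mk_mem_prod ht (hSv hmem))
  rw [Set.mem_ofPred_eq, map_smul] at h1
  exact hermForm_neg_of_smul h1

/-- Here `N` is the constant matrix `e` plus a block that ignores coordinate `0`. Taking coordinate
`0` to be `a - ∑ x i` makes the coordinate sum equal `a`, so the form decouples into `e |a|²` and
the block form; `a` is a free extra direction if `e < 0` and is set to `0` otherwise. -/
theorem NegDefOnDim.cons {n : ℕ} {M : Matrix (Fin n) (Fin n) ℂ} {k : ℕ} (h : NegDefOnDim M k)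
    {e : ℝ} {z : Fin n → ℂ} (hz : ∀ i, z i ≠ 0) {N : Matrix (Fin (n + 1)) (Fin (n + 1)) ℂ}
    (h00 : N 0 0 = e) (h0 : ∀ j : Fin n, N 0 j.succ = e) (h0' : ∀ i : Fin n, N i.succ 0 = e)
    (hs : ∀ i j : Fin n, N i.succ j.succ = e + z i * M i j * star (z j)) :
    NegDefOnDim N (k + if e < 0 then 1 else 0) := by
  obtain ⟨L, hL⟩ := h.congr_diagonal (M := Matrix.of fun i j => z i * M i j * star (z j)) z hz
    (fun i j => rfl)
  have key : ∀ (a : ℂ) (x : Fin n → ℂ), hermForm N (Fin.cons (a - ∑ i, x i) x) =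
      e * (star a * a) + hermForm (Matrix.of fun i j => z i * M i j * star (z j)) x := by
    intro a x
    simp only [hermForm, Fin.sum_univ_succ, Fin.cons_zero, Fin.cons_succ, h00, h0, h0', hs,
      Matrix.of_apply]
    have h1 : star (a - ∑ i, x i) = star a - ∑ i, star (x i) := by simp
    have h2 : ∀ i, ∑ j, star (x i) * (↑e + z i * M i j * star (z j)) * x j =
        star (x i) * (e * ∑ j, x j) + ∑ j, star (x i) * (z i * M i j * star (z j)) * x j := by
      intro i
      simp only [mul_add, add_mul, Finset.sum_add_distrib, Finset.mul_sum]
      congr 1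
      exact Finset.sum_congr rfl fun j _ => by ring
    have h3 : ∑ j, star (a - ∑ i, x i) * (e : ℂ) * x j = star (a - ∑ i, x i) * e * ∑ j, x j := by
      rw [Finset.mul_sum]
    have h4 : ∑ i, star (x i) * (e : ℂ) * (a - ∑ i, x i) =
        (∑ i, star (x i)) * (e * (a - ∑ i, x i)) := by
      rw [Finset.sum_mul]; exact Finset.sum_congr rfl fun j _ => by ring
    rw [Finset.sum_add_distrib, h4, Finset.sum_congr rfl fun i _ => h2 i, Finset.sum_add_distrib,
      ← Finset.sum_mul, h3, h1]
    ring
  split_ifs with he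
  · let tl : (Fin (k + 1) → ℂ) →ₗ[ℂ] (Fin n → ℂ) := L ∘ₗ LinearMap.funLeft ℂ ℂ Fin.succ
    let L' : (Fin (k + 1) → ℂ) →ₗ[ℂ] (Fin (n + 1) → ℂ) :=
      LinearMap.pi (Fin.cons (LinearMap.proj 0 - ∑ i, LinearMap.proj i ∘ₗ tl)
        fun i => LinearMap.proj i ∘ₗ tl)
    have hL' : ∀ c, L' c = Fin.cons (c 0 - ∑ i, tl c i) (tl c) := by
      intro c
      ext i
      refine Fin.cases ?_ (fun i => ?_) i <;> simp [L']
    refine ⟨L', fun c hc => ?_⟩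
    have hsq : (star (c 0) * c 0 : ℂ) = ((‖c 0‖ ^ 2 : ℝ) : ℂ) := by
      rw [RCLike.star_def, Complex.conj_mul']; simp
    rw [hL', key, hsq, ← Complex.ofReal_mul, Complex.add_re, Complex.ofReal_re]
    by_cases hc' : LinearMap.funLeft ℂ ℂ Fin.succ c = 0
    · have h0 : c 0 ≠ 0 := by
        intro h0
        refine hc (funext fun i => Fin.cases h0 (fun i => ?_) i)
        exact congrFun hc' i
      have : tl c = 0 := by simp only [tl, LinearMap.comp_apply, hc', map_zero]
      have h0' : 0 < ‖c 0‖ := norm_pos_iff.2 h0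
      rw [this]
      simp only [hermForm, Pi.zero_apply, mul_zero, Finset.sum_const_zero, Complex.zero_re,
        add_zero]
      exact mul_neg_of_neg_of_pos he (by positivity)
    · have := hL _ hc'
      have h2 : e * ‖c 0‖ ^ 2 ≤ 0 := mul_nonpos_of_nonpos_of_nonneg he.le (by positivity)
      exact add_neg_of_nonpos_of_neg h2 this
  · let L' : (Fin k → ℂ) →ₗ[ℂ] (Fin (n + 1) → ℂ) :=
      LinearMap.pi (Fin.cons (- ∑ i, LinearMap.proj i ∘ₗ L) fun i => LinearMap.proj i ∘ₗ L)
    have hL' : ∀ c, L' c = Fin.cons (0 - ∑ i, L c i) (L c) := by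
      intro c
      ext i
      refine Fin.cases ?_ (fun i => ?_) i <;> simp [L']
    refine ⟨L', fun c hc => ?_⟩
    rw [hL', key]
    simpa using hL c hc

end

/-! ### Pick matrices under one step of the fraction, and convergence near `0`. -/

section

theorem pickMatrix_congr {f g : ℂ → ℂ} {n : ℕ} {z : Fin n → ℂ} (h : ∀ i, f (z i) = g (z i)) :
    pickMatrix f z = pickMatrix g z := by
  ext i j
  simp only [pickMatrix, Matrix.of_apply, h]

theorem sub_conj_ne_zero {z w : ℂ} (hz : 0 < z.im) (hw : 0 < w.im) :
    z - (starRingEnd ℂ) w ≠ 0 := by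
  intro h
  have := congrArg Complex.im h
  simp at this
  linarith

/-- Write `f - f̄' = f f̄' (1 / f̄' - 1 / f)`, the prime marking the second point, and substitute `1
/ f = (1 - z g) / a`. -/
theorem pickMatrix_step {f g : ℂ → ℂ} {n : ℕ} {z : Fin n → ℂ} {a : ℝ} (ha : a ≠ 0)
    (hz : ∀ i, 0 < (z i).im) (h : ∀ i, f (z i) * (1 - z i * g (z i)) = a) (e : ℝ) (i j : Fin n) :
    pickMatrix (fun w => (e : ℂ) * f w) z i j =
      (f (z i) / a) * pickMatrix (fun w => w * (((e * a : ℝ) : ℂ) * g w)) z i j *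
        star (f (z j) / a) := by
  have hd := sub_conj_ne_zero (hz i) (hz j)
  have ha' : (a : ℂ) ≠ 0 := by exact_mod_cast ha
  have h1 := h i
  have h2 := congrArg (starRingEnd ℂ) (h j)
  simp only [map_mul, map_sub, map_one, Complex.conj_ofReal] at h2
  simp only [pickMatrix, Matrix.of_apply, map_mul, RCLike.star_def, map_div₀, Complex.conj_ofReal]
  field_simp
  push_cast
  generalize f (z i) = F at *
  generalize g (z i) = G at *
  generalize (starRingEnd ℂ) (f (z j)) = F' at *
  generalize (starRingEnd ℂ) (g (z j)) = G' at *
  linear_combination (e * a * F') * h1 - (e * a * F) * h2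

/-- The same substitution gives `z f - w̄ f̄' = (f f̄' / a) ((z - w̄) + z w̄ (g - ḡ'))`; dividing by
`z - w̄` turns the first term into the constant. -/
theorem pickMatrix_id_mul_step {f g : ℂ → ℂ} {n : ℕ} {z : Fin n → ℂ} {a : ℝ} (ha : a ≠ 0)
    (hz : ∀ i, 0 < (z i).im) (h : ∀ i, f (z i) * (1 - z i * g (z i)) = a) (e : ℝ) (i j : Fin n) :
    pickMatrix (fun w => w * ((e : ℂ) * f w)) z i j =
      (f (z i) / a) * (((e * a : ℝ) : ℂ) +
        z i * pickMatrix (fun w => ((e * a : ℝ) : ℂ) * g w) z i j * star (z j)) *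
        star (f (z j) / a) := by
  have hd := sub_conj_ne_zero (hz i) (hz j)
  have ha' : (a : ℂ) ≠ 0 := by exact_mod_cast ha
  have h1 := h i
  have h2 := congrArg (starRingEnd ℂ) (h j)
  simp only [map_mul, map_sub, map_one, Complex.conj_ofReal] at h2
  simp only [pickMatrix, Matrix.of_apply, map_mul, RCLike.star_def, map_div₀, Complex.conj_ofReal]
  field_simp
  push_cast
  generalize f (z i) = F at *
  generalize g (z i) = G at *
  generalize (starRingEnd ℂ) (f (z j)) = F' at *
  generalize (starRingEnd ℂ) (g (z j)) = G' at *
  generalize (starRingEnd ℂ) (z j) = Y at *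
  linear_combination (e * a * F' * Y) * h1 - (e * a * F * z i) * h2

/-- The bound `|1 - z g| ≥ 3/4` behind the convergence of the continued fraction near `0`. -/
theorem three_quarters_le_norm {C : ℝ} {z g : ℂ} (hz : ‖z‖ * (8 * C) ≤ 1) (hg : ‖g‖ ≤ 2 * C) :
    3 / 4 ≤ ‖1 - z * g‖ := by
  have h1 : ‖z * g‖ ≤ 1 / 4 := by
    rw [norm_mul]
    nlinarith [norm_nonneg z, norm_nonneg g]
  have h2 := norm_sub_norm_le (1 : ℂ) (z * g)
  rw [norm_one] at h2
  linarith

variable {α : ℕ → ℝ} {C : ℝ}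

theorem cfracApprox_succ (α : ℕ → ℝ) (N n : ℕ) (z : ℂ) :
    cfracApprox α (N + 1) n z = α n / (1 - z * cfracApprox α N (n + 1) z) := rfl

theorem norm_cfracApprox_le (hC : ∀ n, |α n| ≤ C) {z : ℂ} (hz : ‖z‖ * (8 * C) ≤ 1) (N n : ℕ) :
    ‖cfracApprox α N n z‖ ≤ 2 * C := by
  have h0 : ∀ n, ‖(α n : ℂ)‖ ≤ C := fun n => by simpa using hC n
  have hC0 : 0 ≤ C := (abs_nonneg _).trans (hC 0)
  induction N generalizing n with
  | zero => simp only [cfracApprox]; linarith [h0 n]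
  | succ N ih =>
    have h1 := three_quarters_le_norm hz (ih (n + 1))
    simp only [cfracApprox]
    rw [norm_div, div_le_iff₀ (by linarith)]
    nlinarith [h0 n]

/-- Each level contracts: `|α z| ≤ 1/8` and the two denominators have product at least `9/16`,
giving a factor `2/9`, which is below `1/2`. -/
theorem norm_cfracApprox_succ_sub_le (hC : ∀ n, |α n| ≤ C) {z : ℂ} (hz : ‖z‖ * (8 * C) ≤ 1)
    (N n : ℕ) : ‖cfracApprox α N n z - cfracApprox α (N + 1) n z‖ ≤ 4 * C * (1 / 2) ^ N := by
  have h0 : ∀ n, ‖(α n : ℂ)‖ ≤ C := fun n => by simpa using hC n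
  have hC0 : 0 ≤ C := (abs_nonneg _).trans (hC 0)
  induction N generalizing n with
  | zero =>
    have h1 := norm_cfracApprox_le hC hz 0 n
    have h2 := norm_cfracApprox_le hC hz 1 n
    have h3 := norm_sub_le (cfracApprox α 0 n z) (cfracApprox α (0 + 1) n z)
    simp only [zero_add] at *
    linarith
  | succ N ih =>
    have h1 := three_quarters_le_norm hz (norm_cfracApprox_le hC hz N (n + 1))
    have h2 := three_quarters_le_norm hz (norm_cfracApprox_le hC hz (N + 1) (n + 1))
    have ih := ih (n + 1)
    rw [cfracApprox_succ, cfracApprox_succ α (N + 1)]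
    generalize cfracApprox α N (n + 1) z = h at *
    generalize cfracApprox α (N + 1) (n + 1) z = h' at *
    have hd : 1 - z * h ≠ 0 := norm_pos_iff.1 (by linarith)
    have hd' : 1 - z * h' ≠ 0 := norm_pos_iff.1 (by linarith)
    have : (α n : ℂ) / (1 - z * h) - α n / (1 - z * h') =
        (α n * z * (h - h')) / ((1 - z * h) * (1 - z * h')) := by
      field_simp
      ring
    rw [this, norm_div, norm_mul, norm_mul, norm_mul, div_le_iff₀ (by nlinarith)]
    have h3 : (9 : ℝ) / 16 ≤ ‖1 - z * h‖ * ‖1 - z * h'‖ := by nlinarith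
    have h4 : ‖(α n : ℂ)‖ * ‖z‖ ≤ 1 / 8 := by nlinarith [h0 n, norm_nonneg z]
    have h5 : 0 ≤ 4 * C * (1 / 2) ^ N := by positivity
    have h6 : ‖(α n : ℂ)‖ * ‖z‖ * ‖h - h'‖ ≤ 1 / 8 * (4 * C * (1 / 2) ^ N) :=
      mul_le_mul h4 ih (norm_nonneg _) (by norm_num)
    rw [pow_succ]
    nlinarith

/-- The value of the tail `α n / (1 - α (n + 1) z / (1 - ⋯))` of the continued fraction. -/
noncomputable def cfracTail (α : ℕ → ℝ) (n : ℕ) (z : ℂ) : ℂ :=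
  limUnder atTop fun N => cfracApprox α N n z

theorem tendsto_cfracTail (hC : ∀ n, |α n| ≤ C) {z : ℂ} (hz : ‖z‖ * (8 * C) ≤ 1) (n : ℕ) :
    Tendsto (fun N => cfracApprox α N n z) atTop (𝓝 (cfracTail α n z)) := by
  refine CauchySeq.tendsto_limUnder (cauchySeq_of_le_geometric (1 / 2) (4 * C) (by norm_num) ?_)
  intro N
  rw [dist_eq_norm]
  exact norm_cfracApprox_succ_sub_le hC hz N n

theorem tendstoUniformlyOn_cfracTail (hC : ∀ n, |α n| ≤ C) (n : ℕ) :
    TendstoUniformlyOn (fun N z => cfracApprox α N n z) (cfracTail α n) atTop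
      {z : ℂ | ‖z‖ * (8 * C) < 1} := by
  rw [Metric.tendstoUniformlyOn_iff]
  intro ε hε
  have hlim : Tendsto (fun N : ℕ => 4 * C * (1 / 2 : ℝ) ^ N / (1 - 1 / 2)) atTop (𝓝 0) := by
    have := ((tendsto_pow_atTop_nhds_zero_of_lt_one (r := (1 / 2 : ℝ)) (by norm_num)
      (by norm_num)).const_mul (4 * C)).div_const (1 - 1 / 2)
    simpa using this
  filter_upwards [hlim.eventually (gt_mem_nhds hε)] with N hN z hz
  have hz' : ‖z‖ * (8 * C) ≤ 1 := le_of_lt hz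
  rw [dist_comm]
  refine lt_of_le_of_lt (dist_le_of_le_geometric_of_tendsto (1 / 2) (4 * C) (by norm_num) ?_
    (tendsto_cfracTail hC hz' n) N) hN
  intro N
  rw [dist_eq_norm]
  exact norm_cfracApprox_succ_sub_le hC hz' N n

theorem isOpen_cfracDisc (C : ℝ) : IsOpen {z : ℂ | ‖z‖ * (8 * C) < 1} :=
  isOpen_lt (by fun_prop) continuous_const

theorem cfracDisc_mem_nhds (C : ℝ) : {z : ℂ | ‖z‖ * (8 * C) < 1} ∈ 𝓝 (0 : ℂ) :=
  (isOpen_cfracDisc C).mem_nhds (by simp)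

theorem differentiableOn_cfracApprox (hC : ∀ n, |α n| ≤ C) (N n : ℕ) :
    DifferentiableOn ℂ (cfracApprox α N n) {z : ℂ | ‖z‖ * (8 * C) < 1} := by
  induction N generalizing n with
  | zero => exact differentiableOn_const _
  | succ N ih =>
    refine (differentiableOn_const _).div
      ((differentiableOn_const _).sub (differentiableOn_id.mul (ih (n + 1)))) fun z hz => ?_
    have := three_quarters_le_norm (le_of_lt hz) (norm_cfracApprox_le hC (le_of_lt hz) N (n + 1))
    exact norm_pos_iff.1 (lt_of_lt_of_le (by norm_num) this)

theorem analyticOnNhd_cfracTail (hC : ∀ n, |α n| ≤ C) (n : ℕ) :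
    AnalyticOnNhd ℂ (cfracTail α n) {z : ℂ | ‖z‖ * (8 * C) < 1} :=
  ((tendstoUniformlyOn_cfracTail hC n).tendstoLocallyUniformlyOn.differentiableOn
    (Eventually.of_forall fun N => differentiableOn_cfracApprox hC N n)
    (isOpen_cfracDisc C)).analyticOnNhd (isOpen_cfracDisc C)

/-- The recurrence is kept free of division because this is the hypothesis of the Pick matrix
identities. -/
theorem cfracTail_mul (hC : ∀ n, |α n| ≤ C) {z : ℂ} (hz : ‖z‖ * (8 * C) ≤ 1) (n : ℕ) :
    cfracTail α n z * (1 - z * cfracTail α (n + 1) z) = α n := by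
  have h1 := ((tendsto_cfracTail hC hz n).comp (tendsto_add_atTop_nat 1)).mul
    (((tendsto_cfracTail hC hz (n + 1)).const_mul z).const_sub 1)
  refine tendsto_nhds_unique h1 (tendsto_const_nhds.congr fun N => ?_)
  have := three_quarters_le_norm hz (norm_cfracApprox_le hC hz N (n + 1))
  have hd : 1 - z * cfracApprox α N (n + 1) z ≠ 0 := norm_pos_iff.1 (by linarith)
  simp only [Function.comp_apply, cfracApprox]
  field_simp

end

/-! ### Lower bounds on the index, from points near `0`. -/

section

/-- The Pick form of `f` is negative definite on `k`-dimensional spaces for families of points of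
the upper half-plane arbitrarily close to `0`. -/
def PickNegNearZero (f : ℂ → ℂ) (k : ℕ) : Prop :=
  ∀ δ > 0, ∃ (n : ℕ) (z : Fin n → ℂ), (∀ i, 0 < (z i).im ∧ ‖z i‖ < δ) ∧
    NegDefOnDim (pickMatrix f z) k

theorem pickNegNearZero_zero (f : ℂ → ℂ) : PickNegNearZero f 0 := fun _ _ =>
  ⟨0, Fin.elim0, fun i => i.elim0, 0, fun _ hc => (hc (Subsingleton.elim _ _)).elim⟩

theorem exists_ball_of_eventually_nhdsWithin {p : ℂ → Prop}
    (h : ∀ᶠ z in 𝓝[{z : ℂ | 0 < z.im}] 0, p z) :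
    ∃ r > 0, ∀ z : ℂ, 0 < z.im → ‖z‖ < r → p z := by
  rw [eventually_nhdsWithin_iff, Metric.eventually_nhds_iff] at h
  obtain ⟨r, hr, h⟩ := h
  exact ⟨r, hr, fun z hz hzr => h (by simpa using hzr) hz⟩

theorem PickNegNearZero.congr {f g : ℂ → ℂ} {k : ℕ} (h : PickNegNearZero f k)
    (hfg : ∀ᶠ z in 𝓝[{z : ℂ | 0 < z.im}] 0, g z = f z) : PickNegNearZero g k := by
  obtain ⟨r, hr, hfg⟩ := exists_ball_of_eventually_nhdsWithin hfg
  intro δ hδ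
  obtain ⟨n, z, hz, hneg⟩ := h (min δ r) (lt_min hδ hr)
  refine ⟨n, z, fun i => ⟨(hz i).1, (hz i).2.trans_le (min_le_left _ _)⟩, ?_⟩
  rwa [pickMatrix_congr fun i => hfg (z i) (hz i).1 ((hz i).2.trans_le (min_le_right _ _))]

theorem PickNegNearZero.step {f g : ℂ → ℂ} {a : ℝ} (ha : a ≠ 0)
    (hfg : ∀ᶠ z in 𝓝[{z : ℂ | 0 < z.im}] 0, f z * (1 - z * g z) = a) {e : ℝ} {k : ℕ}
    (h : PickNegNearZero (fun w => w * (((e * a : ℝ) : ℂ) * g w)) k) :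
    PickNegNearZero (fun w => (e : ℂ) * f w) k := by
  obtain ⟨r, hr, hfg⟩ := exists_ball_of_eventually_nhdsWithin hfg
  intro δ hδ
  obtain ⟨n, z, hz, hneg⟩ := h (min δ r) (lt_min hδ hr)
  have hfz : ∀ i, f (z i) * (1 - z i * g (z i)) = a := fun i =>
    hfg (z i) (hz i).1 ((hz i).2.trans_le (min_le_right _ _))
  have ha' : (a : ℂ) ≠ 0 := by exact_mod_cast ha
  refine ⟨n, z, fun i => ⟨(hz i).1, (hz i).2.trans_le (min_le_left _ _)⟩, ?_⟩
  exact hneg.congr_diagonal (fun i => f (z i) / a)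
    (fun i => div_ne_zero (left_ne_zero_of_mul ((hfz i).trans_ne ha')) ha')
    (pickMatrix_step ha (fun i => (hz i).1) hfz e)

/-- Adjoining the point `iy`, the factors `z_i` and `conj z_j` kill its row and column as `y → 0`,
since `g` stays bounded there. The limit has the shape required by `NegDefOnDim.cons`. -/
theorem tendsto_shifted_pickMatrix {g : ℂ → ℂ} (hg : ContinuousAt g 0) (e : ℝ) {n : ℕ}
    {z : Fin n → ℂ} (hz : ∀ i, 0 < (z i).im) :
    Tendsto (fun y : ℝ => Matrix.of fun i j => (e : ℂ) +
        (Fin.cons (y * Complex.I) z : Fin (n + 1) → ℂ) i *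
          pickMatrix g (Fin.cons (y * Complex.I) z) i j *
          star ((Fin.cons (y * Complex.I) z : Fin (n + 1) → ℂ) j)) (𝓝[>] 0)
      (𝓝 (Matrix.of fun i j => (e : ℂ) + Fin.cases 0 (fun i' => Fin.cases 0
        (fun j' => z i' * pickMatrix g z i' j' * star (z j')) j) i)) := by
  have hy : Tendsto (fun y : ℝ => (y : ℂ) * Complex.I) (𝓝[>] 0) (𝓝 0) := by
    have : Continuous fun y : ℝ => (y : ℂ) * Complex.I := by fun_prop
    simpa using (this.tendsto 0).mono_left nhdsWithin_le_nhds
  have hgy : Tendsto (fun y : ℝ => g (y * Complex.I)) (𝓝[>] 0) (𝓝 (g 0)) := hg.tendsto.comp hy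
  have hconj : Tendsto (fun y : ℝ => (starRingEnd ℂ) ((y : ℂ) * Complex.I)) (𝓝[>] 0) (𝓝 0) := by
    have := (Complex.continuous_conj.tendsto 0).comp hy
    rwa [map_zero] at this
  have hgconj : Tendsto (fun y : ℝ => (starRingEnd ℂ) (g (y * Complex.I))) (𝓝[>] 0)
    (𝓝 ((starRingEnd ℂ) (g 0))) := (Complex.continuous_conj.tendsto _).comp hgy
  have hz0 : ∀ i, z i ≠ 0 := fun i h => by simpa [h] using hz i
  refine tendsto_pi_nhds.2 fun i => tendsto_pi_nhds.2 fun j => ?_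
  simp only [Matrix.of_apply]
  refine tendsto_const_nhds.add ?_
  refine Fin.cases ?_ (fun i' => ?_) i <;> refine Fin.cases ?_ (fun j' => ?_) j
  -- In the corner the kernel has denominator `2iy`, but the prefactor is of order `y²`, so one
  -- factor `y` survives.
  · have h1 : Tendsto (fun y : ℝ => (y : ℂ) * Complex.I *
        ((g (y * Complex.I) - (starRingEnd ℂ) (g (y * Complex.I))) * (-1 / 2))) (𝓝[>] 0) (𝓝 0) := by
      simpa using hy.mul ((hgy.sub hgconj).mul_const (-1 / 2 : ℂ))
    refine h1.congr' ?_
    filter_upwards [self_mem_nhdsWithin] with y hy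
    have hy' : (y : ℂ) ≠ 0 := by exact_mod_cast (ne_of_gt hy)
    have hI := Complex.I_ne_zero
    simp only [Fin.cons_zero, pickMatrix, Matrix.of_apply, map_mul, Complex.conj_ofReal,
      Complex.conj_I, RCLike.star_def]
    have : (y : ℂ) * Complex.I - y * -Complex.I = 2 * (y * Complex.I) := by ring
    rw [this]
    field_simp
  · have h1 := (hy.mul ((hgy.sub_const ((starRingEnd ℂ) (g (z j')))).div
      (hy.sub_const ((starRingEnd ℂ) (z j'))) (by simpa using hz0 j'))).mul_const (star (z j'))
    simpa [pickMatrix] using h1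
  · have h1 := ((((hgconj.const_sub (g (z i'))).div (hconj.const_sub (z i'))
      (by simpa using hz0 i')).const_mul (z i')).mul hconj)
    simpa [pickMatrix] using h1
  · simp [pickMatrix]

theorem PickNegNearZero.id_mul_step {f g : ℂ → ℂ} {a : ℝ} (ha : a ≠ 0)
    (hfg : ∀ᶠ z in 𝓝[{z : ℂ | 0 < z.im}] 0, f z * (1 - z * g z) = a) (hg : ContinuousAt g 0)
    {e : ℝ} {k : ℕ} (h : PickNegNearZero (fun w => ((e * a : ℝ) : ℂ) * g w) k) :
    PickNegNearZero (fun w => w * ((e : ℂ) * f w)) (k + if e * a < 0 then 1 else 0) := by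
  obtain ⟨r, hr, hfg⟩ := exists_ball_of_eventually_nhdsWithin hfg
  intro δ hδ
  have hρ : 0 < min δ r := lt_min hδ hr
  obtain ⟨n, z, hz, hneg⟩ := h (min δ r) hρ
  have ha' : (a : ℂ) ≠ 0 := by exact_mod_cast ha
  have hz0 : ∀ i, z i ≠ 0 := fun i h => by simpa [h] using (hz i).1
  have hlim := tendsto_shifted_pickMatrix (g := fun w => ((e * a : ℝ) : ℂ) * g w)
    (continuousAt_const.mul hg) (e * a) fun i => (hz i).1
  have hN := hneg.cons (e := e * a) hz0 (N := Matrix.of fun i j => ((e * a : ℝ) : ℂ) +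
    Fin.cases 0 (fun i' => Fin.cases 0 (fun j' => z i' *
      pickMatrix (fun w => ((e * a : ℝ) : ℂ) * g w) z i' j' * star (z j')) j) i)
    (by simp) (fun j => by simp) (fun i => by simp) (fun i j => by simp)
  have hpos : ∀ᶠ y : ℝ in 𝓝[>] 0, 0 < y := self_mem_nhdsWithin
  have hlt : ∀ᶠ y : ℝ in 𝓝[>] 0, y < min δ r := mem_nhdsWithin_of_mem_nhds (gt_mem_nhds hρ)
  obtain ⟨y, hy, hy0, hyr⟩ := ((hN.eventually hlim).and (hpos.and hlt)).exists
  have hw : ∀ i, 0 < ((Fin.cons (y * Complex.I) z : Fin (n + 1) → ℂ) i).im ∧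
      ‖(Fin.cons (y * Complex.I) z : Fin (n + 1) → ℂ) i‖ < min δ r := by
    intro i
    refine Fin.cases ?_ (fun i => ?_) i
    · rw [Fin.cons_zero, norm_mul, Complex.norm_I, mul_one, Complex.norm_real,
        Real.norm_of_nonneg hy0.le]
      exact ⟨by simpa using hy0, hyr⟩
    · simpa using hz i
  generalize (Fin.cons (y * Complex.I) z : Fin (n + 1) → ℂ) = w at hy hw
  have hfz : ∀ i, f (w i) * (1 - w i * g (w i)) = a := fun i =>
    hfg (w i) (hw i).1 ((hw i).2.trans_le (min_le_right _ _))
  refine ⟨n + 1, w, fun i => ⟨(hw i).1, (hw i).2.trans_le (min_le_left _ _)⟩, ?_⟩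
  exact hy.congr_diagonal (fun i => f (w i) / a)
    (fun i => div_ne_zero (left_ne_zero_of_mul ((hfz i).trans_ne ha')) ha')
    (pickMatrix_id_mul_step ha (fun i => (hw i).1) hfz e)

/-- The number of indices `i < s` of parity `p` such that `e (j + i + 1) < 0`. -/
noncomputable def altNegCount (e : ℕ → ℝ) (p s j : ℕ) : ℕ :=
  ∑ i ∈ Finset.range s, if i % 2 = p ∧ e (j + i + 1) < 0 then 1 else 0

theorem altNegCount_one_succ (e : ℕ → ℝ) (s j : ℕ) :
    altNegCount e 1 (s + 1) j = altNegCount e 0 s (j + 1) := by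
  simp only [altNegCount]
  rw [Finset.sum_range_succ']
  simp only [Nat.zero_mod, zero_ne_one, false_and, if_false, add_zero]
  refine Finset.sum_congr rfl fun i _ => if_congr ?_ rfl rfl
  rw [show j + (i + 1) + 1 = j + 1 + i + 1 by ring, show (i + 1) % 2 = 1 ↔ i % 2 = 0 by omega]

theorem altNegCount_zero_succ (e : ℕ → ℝ) (s j : ℕ) :
    altNegCount e 0 (s + 1) j = altNegCount e 1 s (j + 1) + if e (j + 1) < 0 then 1 else 0 := by
  simp only [altNegCount]
  rw [Finset.sum_range_succ']
  simp only [Nat.zero_mod, true_and, add_zero]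
  congr 1
  refine Finset.sum_congr rfl fun i _ => if_congr ?_ rfl rfl
  rw [show j + (i + 1) + 1 = j + 1 + i + 1 by ring, show (i + 1) % 2 = 0 ↔ i % 2 = 1 by omega]

/-- The two claims feed each other with shifted index, hence the alternating parity. The number `s`
of steps is arbitrary, which is what later makes the index unbounded. -/
theorem pickNegNearZero_cfracTail {α e : ℕ → ℝ} {C : ℝ} (hα : ∀ n, α n ≠ 0)
    (hC : ∀ n, |α n| ≤ C) (he : ∀ n, e (n + 1) = e n * α n) (s j : ℕ) :
    PickNegNearZero (fun w => (e j : ℂ) * cfracTail α j w) (altNegCount e 1 s j) ∧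
      PickNegNearZero (fun w => w * ((e j : ℂ) * cfracTail α j w)) (altNegCount e 0 s j) := by
  induction s generalizing j with
  | zero => exact ⟨pickNegNearZero_zero _, pickNegNearZero_zero _⟩
  | succ s ih =>
    have hfg : ∀ᶠ z in 𝓝[{z : ℂ | 0 < z.im}] 0,
        cfracTail α j z * (1 - z * cfracTail α (j + 1) z) = α j := by
      filter_upwards [mem_nhdsWithin_of_mem_nhds (cfracDisc_mem_nhds C)] with z hz
      exact cfracTail_mul hC (le_of_lt hz) j
    have hg : ContinuousAt (cfracTail α (j + 1)) 0 :=
      (analyticOnNhd_cfracTail hC (j + 1) 0 (mem_of_mem_nhds (cfracDisc_mem_nhds C))).continuousAt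
    obtain ⟨h1, h2⟩ := ih (j + 1)
    rw [altNegCount_one_succ, altNegCount_zero_succ]
    rw [he] at h1 h2 ⊢
    exact ⟨h2.step (hα j) hfg, h1.id_mul_step (hα j) hfg hg⟩

theorem PickNegNearZero.exists_le_pickNegSquares {f : ℂ → ℂ} {k : ℕ} (h : PickNegNearZero f k)
    (hf : AnalyticAt ℂ f 0) {F : ℂ → ℂ} (hF : ∀ᶠ z in 𝓝[{z : ℂ | 0 < z.im}] 0, F z = f z) :
    ∃ (n : ℕ) (z : Fin n → ℂ), PickAdmissible F z ∧ k ≤ pickNegSquares F z := by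
  obtain ⟨r, hr, hFf⟩ := exists_ball_of_eventually_nhdsWithin hF
  obtain ⟨r', hr', hf'⟩ := Metric.eventually_nhds_iff.1 hf.eventually_analyticAt
  obtain ⟨n, z, hz, hneg⟩ := (h.congr hF) (min r r') (lt_min hr hr')
  refine ⟨n, z, fun i => ⟨(hz i).1, ?_⟩, ?_⟩
  · have hfi : AnalyticAt ℂ f (z i) :=
      hf' (by simpa using (hz i).2.trans_le (min_le_right _ _))
    refine hfi.congr ?_
    have ho : IsOpen {w : ℂ | 0 < w.im ∧ ‖w‖ < r} :=
      (isOpen_lt continuous_const Complex.continuous_im).inter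
        (isOpen_lt continuous_norm continuous_const)
    filter_upwards [ho.mem_nhds ⟨(hz i).1, (hz i).2.trans_le (min_le_left _ _)⟩] with w hw
    exact (hFf w hw.1 hw.2).symm
  · exact hneg.le (pickMatrix_isHermitian F z).negRankLE

end

/-! ### Positive tails: extension to the upper half-plane with index zero. -/

section

theorem isOpen_upperHalf : IsOpen {z : ℂ | 0 < z.im} :=
  isOpen_lt continuous_const Complex.continuous_im

/-- A pointwise limit of locally uniformly bounded holomorphic functions is holomorphic. -/
theorem differentiableOn_of_tendsto_of_locally_bounded {β : Type*} {l : Filter β} [l.NeBot]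
    {F : β → ℂ → ℂ} {g : ℂ → ℂ} {U : Set ℂ} (hU : IsOpen U)
    (hF : ∀ N, DifferentiableOn ℂ (F N) U)
    (hb : ∀ x ∈ U, ∃ B : ℝ, ∀ᶠ y in 𝓝 x, ∀ N, ‖F N y‖ ≤ B)
    (hg : ∀ x ∈ U, Tendsto (fun N => F N x) l (𝓝 (g x))) : DifferentiableOn ℂ g U := by
  suffices h : TendstoLocallyUniformlyOn F g l U from
    h.differentiableOn (Eventually.of_forall hF) hU
  rw [Metric.tendstoLocallyUniformlyOn_iff]
  intro ε hε x hx
  obtain ⟨B, hB⟩ := hb x hx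
  obtain ⟨R, hR, hball⟩ := Metric.eventually_nhds_iff_ball.1 (hB.and (hU.mem_nhds hx))
  -- Discs of radius `R / 3` centred in the ball of radius `R / 3` stay in the ball of radius `R`,
  -- so Cauchy's estimate yields a Lipschitz constant independent of `N`. Equicontinuity then
  -- upgrades pointwise convergence to locally uniform convergence.
  have hR2 : 0 < R / 3 := by positivity
  set K := B / (R / 3) with hK
  have hlip : ∀ N, ∀ y ∈ Metric.ball x (R / 3), ‖F N y - F N x‖ ≤ K * ‖y - x‖ := by
    intro N y hy
    refine (convex_ball x (R / 3)).norm_image_sub_le_of_norm_deriv_le (𝕜 := ℂ) (f := F N)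
      (fun w hw => ?_) (fun w hw => ?_) (Metric.mem_ball_self hR2) hy
    · exact (hF N).differentiableAt (hU.mem_nhds
        (hball w (Metric.ball_subset_ball (by linarith) hw)).2)
    · have hsub : Metric.closedBall w (R / 3) ⊆ Metric.ball x R := by
        intro v hv
        have h1 := dist_triangle v w x
        rw [Metric.mem_closedBall] at hv
        rw [Metric.mem_ball] at hw ⊢
        linarith
      refine Complex.norm_deriv_le_of_forall_mem_sphere_norm_le hR2 ?_ fun v hv =>
        (hball v (hsub (Metric.sphere_subset_closedBall hv))).1 N
      exact ((hF N).mono fun v hv => (hball v (hsub hv)).2).diffContOnCl_ball subset_rfl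
  have hlipg : ∀ y ∈ Metric.ball x (R / 3), ‖g y - g x‖ ≤ K * ‖y - x‖ := by
    intro y hy
    have hyU := (hball y (Metric.ball_subset_ball (by linarith) hy)).2
    exact le_of_tendsto ((hg y hyU).sub (hg x hx)).norm (Eventually.of_forall fun N => hlip N y hy)
  have hsmall : ∀ᶠ y in 𝓝 x, K * ‖y - x‖ < ε / 3 := by
    have : Tendsto (fun y => K * ‖y - x‖) (𝓝 x) (𝓝 (K * ‖x - x‖)) :=
      Continuous.tendsto (by fun_prop) x
    rw [sub_self, norm_zero, mul_zero] at this
    exact this.eventually (gt_mem_nhds (by positivity))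
  refine ⟨{y | y ∈ Metric.ball x (R / 3) ∧ K * ‖y - x‖ < ε / 3},
    mem_nhdsWithin_of_mem_nhds (inter_mem (Metric.ball_mem_nhds x hR2) hsmall), ?_⟩
  filter_upwards [(Metric.tendsto_nhds.1 (hg x hx)) (ε / 3) (by positivity)] with N hN y hy
  have h1 := hlip N y hy.1
  have h2 := hlipg y hy.1
  have h3 := hy.2
  rw [dist_eq_norm] at hN ⊢
  have h4 : g y - F N y = (g y - g x) - (F N x - g x) - (F N y - F N x) := by ring
  rw [h4]
  have h5 := norm_sub_le ((g y - g x) - (F N x - g x)) (F N y - F N x)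
  have h6 := norm_sub_le (g y - g x) (F N x - g x)
  linarith

open scoped ComplexOrder

/-- Both `g` and `z g(z)` have positive semidefinite Pick matrices in the upper half-plane. -/
def IsPickPos (g : ℂ → ℂ) : Prop :=
  ∀ (n : ℕ) (z : Fin n → ℂ), (∀ i, 0 < (z i).im) →
    (pickMatrix g z).PosSemidef ∧ (pickMatrix (fun w => w * g w) z).PosSemidef

theorem NegRankLE.posSemidef {ι : Type*} [Fintype ι] {M : Matrix ι ι ℂ} (h : NegRankLE M 0) :
    M.PosSemidef := by
  obtain ⟨U, hU⟩ := h
  have : U * U.conjTranspose = 0 := by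
    ext i j
    simp [Matrix.mul_apply]
  rwa [this, add_zero] at hU

theorem Matrix.PosSemidef.negRankLE {ι : Type*} [Fintype ι] {M : Matrix ι ι ℂ}
    (h : M.PosSemidef) : NegRankLE M 0 := ⟨0, by simpa using h⟩

theorem negRankLE_pickMatrix_step {f g : ℂ → ℂ} {n : ℕ} {z : Fin n → ℂ} {a : ℝ} (ha : a ≠ 0)
    (hz : ∀ i, 0 < (z i).im) (h : ∀ i, f (z i) * (1 - z i * g (z i)) = a) {e : ℝ} {k : ℕ}
    (hk : NegRankLE (pickMatrix (fun w => w * (((e * a : ℝ) : ℂ) * g w)) z) k) :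
    NegRankLE (pickMatrix (fun w => (e : ℂ) * f w) z) k :=
  hk.congr_diagonal (fun i => f (z i) / a) (pickMatrix_step ha hz h e)

theorem negRankLE_pickMatrix_id_mul_step {f g : ℂ → ℂ} {n : ℕ} {z : Fin n → ℂ} {a : ℝ}
    (ha : a ≠ 0) (hz : ∀ i, 0 < (z i).im) (h : ∀ i, f (z i) * (1 - z i * g (z i)) = a) {e : ℝ}
    {k : ℕ} (hk : NegRankLE (pickMatrix (fun w => ((e * a : ℝ) : ℂ) * g w) z) k) :
    NegRankLE (pickMatrix (fun w => w * ((e : ℂ) * f w)) z) (k + if e * a < 0 then 1 else 0) :=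
  (hk.const_add z (M := Matrix.of fun i j => ((e * a : ℝ) : ℂ) +
    z i * pickMatrix (fun w => ((e * a : ℝ) : ℂ) * g w) z i j * star (z j))
    fun _ _ => rfl).congr_diagonal (fun i => f (z i) / a) (pickMatrix_id_mul_step ha hz h e)

theorem pickMatrix_real_smul (c : ℝ) (f : ℂ → ℂ) {n : ℕ} (z : Fin n → ℂ) :
    pickMatrix (fun w => (c : ℂ) * f w) z = (c : ℂ) • pickMatrix f z := by
  ext i j
  simp only [pickMatrix, Matrix.of_apply, Matrix.smul_apply, map_mul, Complex.conj_ofReal,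
    smul_eq_mul]
  ring

theorem IsPickPos.real_smul {g : ℂ → ℂ} (hg : IsPickPos g) {c : ℝ} (hc : 0 ≤ c) :
    IsPickPos fun w => (c : ℂ) * g w := by
  intro n z hz
  obtain ⟨h1, h2⟩ := hg n z hz
  have hc' : (0 : ℂ) ≤ c := Complex.zero_le_real.2 hc
  refine ⟨?_, ?_⟩
  · rw [pickMatrix_real_smul]
    exact h1.smul hc'
  · have : (fun w => w * ((c : ℂ) * g w)) = fun w => (c : ℂ) * (w * g w) := by
      ext w; ring
    rw [this, pickMatrix_real_smul]
    exact h2.smul hc'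

theorem IsPickPos.im_nonneg {g : ℂ → ℂ} (hg : IsPickPos g) {z : ℂ} (hz : 0 < z.im) :
    0 ≤ (g z).im := by
  have h := (hg 1 (fun _ => z) fun _ => hz).1.diag_nonneg (i := 0)
  simp only [pickMatrix, Matrix.of_apply, Complex.sub_conj] at h
  have h2 : ((2 * (g z).im : ℝ) : ℂ) * Complex.I / (((2 * z.im : ℝ) : ℂ) * Complex.I) =
      (((g z).im / z.im : ℝ) : ℂ) := by
    have := Complex.I_ne_zero
    have hz' : (z.im : ℂ) ≠ 0 := by exact_mod_cast hz.ne'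
    push_cast
    field_simp
  rw [h2, Complex.zero_le_real] at h
  by_contra! hneg
  exact absurd h (not_le.2 (div_neg_of_neg_of_pos hneg hz))

/-- The number `(1 - z g) z̄` has imaginary part `-Im z - |z|² Im g`. This keeps denominators away
from zero throughout the upper half-plane, uniformly in `g`. -/
theorem im_le_norm_one_sub_mul {z g : ℂ} (hg : 0 ≤ g.im) :
    z.im ≤ ‖1 - z * g‖ * ‖z‖ := by
  have h1 : ((1 - z * g) * (starRingEnd ℂ) z).im = -z.im - Complex.normSq z * g.im := by
    simp [Complex.normSq_apply]
    ring
  have h2 := Complex.abs_im_le_norm ((1 - z * g) * (starRingEnd ℂ) z)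
  rw [norm_mul, Complex.norm_conj, h1] at h2
  have h3 : 0 ≤ Complex.normSq z * g.im := mul_nonneg (Complex.normSq_nonneg z) hg
  have h4 := neg_abs_le (-z.im - Complex.normSq z * g.im)
  linarith

theorem one_sub_mul_ne_zero {z g : ℂ} (hz : 0 < z.im) (hg : 0 ≤ g.im) : 1 - z * g ≠ 0 := by
  intro h
  have := im_le_norm_one_sub_mul (z := z) hg
  rw [h, norm_zero, zero_mul] at this
  linarith

theorem IsPickPos.step {f g : ℂ → ℂ} (hg : IsPickPos g) {a : ℝ} (ha : 0 < a)
    (h : ∀ z : ℂ, 0 < z.im → f z * (1 - z * g z) = a) : IsPickPos f := by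
  intro n z hz
  obtain ⟨h1, h2⟩ := hg.real_smul (c := 1 * a) (by simpa using ha.le) n z hz
  have h3 := negRankLE_pickMatrix_step ha.ne' hz (fun i => h (z i) (hz i)) h2.negRankLE
  have h4 := negRankLE_pickMatrix_id_mul_step ha.ne' hz (fun i => h (z i) (hz i)) h1.negRankLE
  rw [if_neg (by linarith)] at h4
  have h5 := h3.posSemidef
  have h6 := h4.posSemidef
  simp only [Complex.ofReal_one, one_mul] at h5 h6
  exact ⟨h5, h6⟩

theorem isPickPos_const {a : ℝ} (ha : 0 < a) : IsPickPos fun _ => (a : ℂ) := by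
  have h0 : IsPickPos fun _ => (0 : ℂ) := by
    intro n z _
    have h : pickMatrix (fun _ => (0 : ℂ)) z = 0 := by ext i j; simp [pickMatrix]
    have h' : pickMatrix (fun w => w * (0 : ℂ)) z = 0 := by ext i j; simp [pickMatrix]
    exact ⟨h ▸ Matrix.PosSemidef.zero, h' ▸ Matrix.PosSemidef.zero⟩
  -- A positive constant is one step applied to the zero tail.
  exact h0.step ha fun z _ => by simp

theorem isPickPos_cfracApprox {α : ℕ → ℝ} {M : ℕ} (hpos : ∀ n, M ≤ n → 0 < α n) (N n : ℕ)
    (hn : M ≤ n) : IsPickPos (cfracApprox α N n) := by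
  induction N generalizing n with
  | zero => exact isPickPos_const (hpos n hn)
  | succ N ih =>
    have := ih (n + 1) (by omega)
    refine this.step (hpos n hn) fun z hz => ?_
    rw [cfracApprox_succ]
    exact div_mul_cancel₀ _ (one_sub_mul_ne_zero hz (this.im_nonneg hz))

theorem norm_cfracApprox_le_of_pos {α : ℕ → ℝ} {M : ℕ} {C : ℝ} (hC : ∀ n, |α n| ≤ C)
    (hpos : ∀ n, M ≤ n → 0 < α n) (N n : ℕ) (hn : M ≤ n) {z : ℂ} (hz : 0 < z.im) :
    ‖cfracApprox α N n z‖ ≤ C * ‖z‖ / z.im := by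
  have h0 : ‖(α n : ℂ)‖ ≤ C := by simpa using hC n
  have hC0 : 0 ≤ C := (abs_nonneg _).trans (hC 0)
  have hzn : z.im ≤ ‖z‖ := (le_abs_self _).trans (Complex.abs_im_le_norm z)
  rw [le_div_iff₀ hz]
  cases N with
  | zero => exact mul_le_mul h0 hzn hz.le hC0
  | succ N =>
    have h1 := (isPickPos_cfracApprox hpos N (n + 1) (by omega)).im_nonneg hz
    have h2 := im_le_norm_one_sub_mul (z := z) h1
    have h3 := one_sub_mul_ne_zero hz h1
    rw [cfracApprox_succ, norm_div, div_mul_eq_mul_div, div_le_iff₀ (norm_pos_iff.2 h3)]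
    calc ‖(α n : ℂ)‖ * z.im ≤ C * (‖1 - z * cfracApprox α N (n + 1) z‖ * ‖z‖) :=
          mul_le_mul h0 h2 hz.le hC0
      _ = _ := by ring

theorem differentiableOn_cfracApprox_of_pos {α : ℕ → ℝ} {M : ℕ}
    (hpos : ∀ n, M ≤ n → 0 < α n) (N n : ℕ) (hn : M ≤ n) :
    DifferentiableOn ℂ (cfracApprox α N n) {z : ℂ | 0 < z.im} := by
  induction N generalizing n with
  | zero => exact differentiableOn_const _
  | succ N ih =>
    refine (differentiableOn_const _).div ((differentiableOn_const _).sub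
      (differentiableOn_id.mul (ih (n + 1) (by omega)))) fun z hz => ?_
    exact one_sub_mul_ne_zero hz
      ((isPickPos_cfracApprox hpos N (n + 1) (by omega)).im_nonneg hz)

theorem tendsto_pickMatrix {β : Type*} {l : Filter β} {F : β → ℂ → ℂ} {g : ℂ → ℂ} {n : ℕ}
    {z : Fin n → ℂ} (h : ∀ i, Tendsto (fun N => F N (z i)) l (𝓝 (g (z i)))) :
    Tendsto (fun N => pickMatrix (F N) z) l (𝓝 (pickMatrix g z)) :=
  tendsto_pi_nhds.2 fun i => tendsto_pi_nhds.2 fun j =>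
    ((h i).sub ((Complex.continuous_conj.tendsto _).comp (h j))).div_const _

theorem posSemidef_of_tendsto {β : Type*} {l : Filter β} [l.NeBot] {n : ℕ}
    {M : β → Matrix (Fin n) (Fin n) ℂ} {M₀ : Matrix (Fin n) (Fin n) ℂ}
    (h : Tendsto M l (𝓝 M₀)) (hM : ∀ N, (M N).PosSemidef) : M₀.PosSemidef := by
  have hentry : ∀ i j, Tendsto (fun N => M N i j) l (𝓝 (M₀ i j)) := fun i j =>
    (tendsto_pi_nhds.1 (tendsto_pi_nhds.1 h i)) j
  refine Matrix.PosSemidef.of_dotProduct_mulVec_nonneg ?_ fun x => ?_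
  · ext i j
    refine tendsto_nhds_unique ((Complex.continuous_conj.tendsto _).comp (hentry j i))
      ((hentry i j).congr fun N => ?_)
    exact ((hM N).isHermitian.apply i j).symm
  · rw [← hermForm_eq_dotProduct]
    have hlim : Tendsto (fun N => hermForm (M N) x) l (𝓝 (hermForm M₀ x)) :=
      tendsto_finsetSum _ fun i _ => tendsto_finsetSum _ fun j _ =>
        ((hentry i j).const_mul _).mul_const _
    refine ge_of_tendsto' hlim fun N => ?_
    rw [hermForm_eq_dotProduct]
    exact (hM N).dotProduct_mulVec_nonneg x

/-- Away from `0` only boundedness of the approximants is available, so the limit is taken along an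
ultrafilter. It is holomorphic by local boundedness, inherits positivity pointwise, and equals the
tail near `0`, where the sequence converges. -/
theorem exists_isPickPos_extension {α : ℕ → ℝ} {M : ℕ} {C : ℝ} (hC : ∀ n, |α n| ≤ C)
    (hpos : ∀ n, M ≤ n → 0 < α n) : ∃ g : ℂ → ℂ, AnalyticOnNhd ℂ g {z : ℂ | 0 < z.im} ∧
      IsPickPos g ∧ ∀ᶠ z in 𝓝[{z : ℂ | 0 < z.im}] 0, g z = cfracTail α M z := by
  have hlim : ∀ z : ℂ, ∃ v : ℂ, 0 < z.im →
      Tendsto (fun N => cfracApprox α N M z) (hyperfilter ℕ) (𝓝 v) := by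
    intro z
    by_cases hz : 0 < z.im
    · have hmem : ((hyperfilter ℕ).map fun N => cfracApprox α N M z : Filter ℂ) ≤
          𝓟 (Metric.closedBall 0 (C * ‖z‖ / z.im)) := by
        rw [le_principal_iff]
        exact mem_map.2 <| univ_mem' fun N => by
          simpa using norm_cfracApprox_le_of_pos hC hpos N M le_rfl hz
      obtain ⟨v, -, hv⟩ := (isCompact_closedBall (0 : ℂ) (C * ‖z‖ / z.im)).ultrafilter_le_nhds
        ((hyperfilter ℕ).map fun N => cfracApprox α N M z) hmem
      exact ⟨v, fun _ => hv⟩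
    · exact ⟨0, fun h => (hz h).elim⟩
  choose g hg using hlim
  refine ⟨g, ?_, ?_, ?_⟩
  · refine (differentiableOn_of_tendsto_of_locally_bounded isOpen_upperHalf
      (fun N => differentiableOn_cfracApprox_of_pos hpos N M le_rfl) (fun x hx => ?_) hg
      ).analyticOnNhd isOpen_upperHalf
    refine ⟨C * ‖x‖ / x.im + 1, ?_⟩
    have hx' : x.im ≠ 0 := ne_of_gt hx
    have hc : ContinuousAt (fun y : ℂ => C * ‖y‖ / y.im) x :=
      ContinuousAt.div (by fun_prop) Complex.continuous_im.continuousAt hx'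
    filter_upwards [hc.eventually (gt_mem_nhds (lt_add_one _)), isOpen_upperHalf.mem_nhds hx]
      with y hy hy' N
    exact (norm_cfracApprox_le_of_pos hC hpos N M le_rfl hy').trans hy.le
  · intro n z hz
    exact ⟨posSemidef_of_tendsto (tendsto_pickMatrix fun i => hg (z i) (hz i)) fun N =>
        (isPickPos_cfracApprox hpos N M le_rfl n z hz).1,
      posSemidef_of_tendsto (tendsto_pickMatrix (F := fun N w => w * cfracApprox α N M w)
        fun i => (hg (z i) (hz i)).const_mul (z i)) fun N =>
        (isPickPos_cfracApprox hpos N M le_rfl n z hz).2⟩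
  · filter_upwards [mem_nhdsWithin_of_mem_nhds (cfracDisc_mem_nhds C), self_mem_nhdsWithin]
      with z hz hz'
    have h1 := (tendsto_cfracTail hC (le_of_lt hz) M).mono_left
      (Nat.hyperfilter_le_atTop)
    exact tendsto_nhds_unique (hg z hz') h1

end

/-! ### Upper bounds on the index, and membership in the classes. -/

section

/-- `e φ` has, near `0` in the upper half-plane, a meromorphic extension `e P / Q` such that on a
dense set of points the Pick forms of `e P / Q` and `z e P / Q` have at most `a` and `b` negative
squares. -/
def HasPickExtension (φ : ℂ → ℂ) (e : ℝ) (a b : ℕ) : Prop :=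
  ∃ (P Q : ℂ → ℂ) (G : Set ℂ), AnalyticOnNhd ℂ P {z : ℂ | 0 < z.im} ∧
    AnalyticOnNhd ℂ Q {z : ℂ | 0 < z.im} ∧ Tendsto Q (𝓝[{z : ℂ | 0 < z.im}] 0) (𝓝 1) ∧
    (∀ᶠ z in 𝓝[{z : ℂ | 0 < z.im}] 0, P z = φ z * Q z) ∧ G ⊆ {z : ℂ | 0 < z.im} ∧
    (∀ z : ℂ, 0 < z.im → ∀ᶠ w in 𝓝[≠] z, w ∈ G) ∧ (∀ w ∈ G, Q w ≠ 0) ∧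
    ∀ (n : ℕ) (z : Fin n → ℂ), (∀ i, z i ∈ G) →
      NegRankLE (pickMatrix (fun w => (e : ℂ) * (P w / Q w)) z) a ∧
      NegRankLE (pickMatrix (fun w => w * ((e : ℂ) * (P w / Q w))) z) b

theorem eventually_mem_upperHalf_punctured {z : ℂ} (hz : 0 < z.im) :
    ∀ᶠ w in 𝓝[≠] z, 0 < w.im :=
  mem_nhdsWithin_of_mem_nhds (isOpen_upperHalf.mem_nhds hz)

theorem neBot_nhdsWithin_upperHalf_zero : (𝓝[{z : ℂ | 0 < z.im}] (0 : ℂ)).NeBot := by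
  rw [← mem_closure_iff_nhdsWithin_neBot, Complex.closure_setOfPred_lt_im]
  simp

/-- By the identity theorem, a non-isolated zero would force `Q = 0` on the half-plane, against the
limit `1` at the boundary point `0`. -/
theorem eventually_ne_zero_of_tendsto_one {Q : ℂ → ℂ}
    (hQ : AnalyticOnNhd ℂ Q {z : ℂ | 0 < z.im})
    (hQ1 : Tendsto Q (𝓝[{z : ℂ | 0 < z.im}] 0) (𝓝 1)) {z : ℂ} (hz : 0 < z.im) :
    ∀ᶠ w in 𝓝[≠] z, Q w ≠ 0 := by
  by_contra hcon
  have hfreq : ∃ᶠ w in 𝓝[≠] z, Q w = 0 := fun h => hcon h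
  have h0 := hQ.eqOn_zero_of_preconnected_of_frequently_eq_zero
    (convex_halfSpace_im_gt 0).isPreconnected hz hfreq
  have := neBot_nhdsWithin_upperHalf_zero
  have h1 : Tendsto Q (𝓝[{z : ℂ | 0 < z.im}] 0) (𝓝 0) :=
    tendsto_const_nhds.congr' (by
      filter_upwards [self_mem_nhdsWithin] with w hw
      exact (h0 hw).symm)
  exact one_ne_zero (tendsto_nhds_unique hQ1 h1)

theorem hasPickExtension_of_isPickPos {φ g : ℂ → ℂ} (hga : AnalyticOnNhd ℂ g {z : ℂ | 0 < z.im})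
    (hg : IsPickPos g) (hφ : ∀ᶠ z in 𝓝[{z : ℂ | 0 < z.im}] 0, g z = φ z) {e : ℝ} (he : 0 ≤ e) :
    HasPickExtension φ e 0 0 := by
  refine ⟨g, fun _ => 1, {z | 0 < z.im}, hga, fun _ _ => analyticAt_const, tendsto_const_nhds,
    by simpa using hφ, subset_rfl, fun z => eventually_mem_upperHalf_punctured, by simp,
    fun n z hz => ?_⟩
  obtain ⟨h1, h2⟩ := hg.real_smul he n z hz
  simp only [div_one]
  exact ⟨h1.negRankLE, h2.negRankLE⟩

/-- With `g = P / Q`, the recurrence gives `f = a Q / (Q - z P)`. The new denominator still tends to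
`1` at `0`, so only isolated points leave `G`. -/
theorem HasPickExtension.step {f g : ℂ → ℂ} {a : ℝ} (ha : a ≠ 0)
    (hfg : ∀ᶠ z in 𝓝[{z : ℂ | 0 < z.im}] 0, f z * (1 - z * g z) = a) (hg : ContinuousAt g 0)
    {e : ℝ} {k l : ℕ} (h : HasPickExtension g (e * a) k l) :
    HasPickExtension f e l (k + if e * a < 0 then 1 else 0) := by
  obtain ⟨P, Q, G, hP, hQ, hQ1, hPQ, hGH, hG, hGQ, hneg⟩ := h
  have hQ' : AnalyticOnNhd ℂ (fun z => Q z - z * P z) {z : ℂ | 0 < z.im} :=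
    hQ.sub (analyticOnNhd_id.mul hP)
  have hQ1' : Tendsto (fun z => Q z - z * P z) (𝓝[{z : ℂ | 0 < z.im}] 0) (𝓝 1) := by
    have h1 : Tendsto (fun z => Q z * (1 - z * g z)) (𝓝[{z : ℂ | 0 < z.im}] 0)
        (𝓝 (1 * (1 - 0 * g 0))) :=
      hQ1.mul (((continuousAt_id.tendsto.mul hg.tendsto).const_sub 1).mono_left nhdsWithin_le_nhds)
    rw [zero_mul, sub_zero, one_mul] at h1
    refine h1.congr' ?_
    filter_upwards [hPQ] with z hz
    rw [hz]; ring
  refine ⟨fun z => a * Q z, fun z => Q z - z * P z, {w | w ∈ G ∧ Q w - w * P w ≠ 0},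
    analyticOnNhd_const.mul hQ, hQ', hQ1', ?_, fun w hw => hGH hw.1,
    fun z hz => (hG z hz).and (eventually_ne_zero_of_tendsto_one hQ' hQ1' hz),
    fun w hw => hw.2, fun n z hz => ?_⟩
  · filter_upwards [hPQ, hfg] with z h1 h2
    rw [h1, ← h2]; ring
  · have hz' : ∀ i, 0 < (z i).im := fun i => hGH (hz i).1
    have hrel : ∀ i, (a * Q (z i) / (Q (z i) - z i * P (z i))) *
        (1 - z i * (P (z i) / Q (z i))) = a := by
      intro i
      have h1 := hGQ _ (hz i).1
      have h2 := (hz i).2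
      field_simp
    obtain ⟨h1, h2⟩ := hneg n z fun i => (hz i).1
    exact ⟨negRankLE_pickMatrix_step (f := fun w => a * Q w / (Q w - w * P w))
        (g := fun w => P w / Q w) ha hz' hrel h2,
      negRankLE_pickMatrix_id_mul_step (f := fun w => a * Q w / (Q w - w * P w))
        (g := fun w => P w / Q w) ha hz' hrel h1⟩

theorem hasPickExtension_cfracTail {α e : ℕ → ℝ} {C : ℝ} (hα : ∀ n, α n ≠ 0)
    (hC : ∀ n, |α n| ≤ C) (he : ∀ n, e (n + 1) = e n * α n) {M : ℕ}
    (hpos : ∀ n, M ≤ n → 0 < α n) (heM : 0 ≤ e M) (s j : ℕ) (hsj : j + s = M) :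
    HasPickExtension (cfracTail α j) (e j) (altNegCount e 1 s j) (altNegCount e 0 s j) := by
  induction s generalizing j with
  | zero =>
    obtain rfl : j = M := by simpa using hsj
    obtain ⟨g, hga, hg, hgφ⟩ := exists_isPickPos_extension hC hpos
    exact hasPickExtension_of_isPickPos hga hg hgφ heM
  | succ s ih =>
    have hfg : ∀ᶠ z in 𝓝[{z : ℂ | 0 < z.im}] 0,
        cfracTail α j z * (1 - z * cfracTail α (j + 1) z) = α j := by
      filter_upwards [mem_nhdsWithin_of_mem_nhds (cfracDisc_mem_nhds C)] with z hz
      exact cfracTail_mul hC (le_of_lt hz) j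
    have hg : ContinuousAt (cfracTail α (j + 1)) 0 :=
      (analyticOnNhd_cfracTail hC (j + 1) 0 (mem_of_mem_nhds (cfracDisc_mem_nhds C))).continuousAt
    have h1 := ih (j + 1) (by omega)
    rw [he] at h1
    rw [altNegCount_one_succ, altNegCount_zero_succ, he]
    exact h1.step (hα j) hfg hg

/-- An admissible family may meet points outside `G`, where the value of `P / Q` carries no
information. Since `F` is continuous at the family, lower semicontinuity moves the negative subspace
to a nearby family inside `G`. -/
theorem pickNegSquares_le_of_dense {F : ℂ → ℂ} {G : Set ℂ} {k : ℕ}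
    (hG : ∀ z : ℂ, 0 < z.im → ∀ᶠ w in 𝓝[≠] z, w ∈ G)
    (hF : ∀ (n : ℕ) (z : Fin n → ℂ), (∀ i, z i ∈ G) → NegRankLE (pickMatrix F z) k) {n : ℕ}
    {z : Fin n → ℂ} (hz : PickAdmissible F z) : pickNegSquares F z ≤ k := by
  have hneg : NegDefOnDim (pickMatrix F z) (pickNegSquares F z) :=
    (pickMatrix_isHermitian F z).negDefOnDim
  have hle : Filter.pi (fun i => 𝓝[≠] (z i)) ≤ 𝓝 z := by
    rw [nhds_pi]
    exact Filter.pi_mono fun i => nhdsWithin_le_nhds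
  have hcoord : ∀ i, Tendsto (fun w : Fin n → ℂ => w i) (𝓝 z) (𝓝 (z i)) := fun i =>
    (continuous_apply i).tendsto z
  have hlim : Tendsto (fun w : Fin n → ℂ => pickMatrix F w) (Filter.pi fun i => 𝓝[≠] (z i))
      (𝓝 (pickMatrix F z)) := by
    refine Tendsto.mono_left ?_ hle
    refine tendsto_pi_nhds.2 fun i => tendsto_pi_nhds.2 fun j => ?_
    have hFi : ∀ i, Tendsto (fun w : Fin n → ℂ => F (w i)) (𝓝 z) (𝓝 (F (z i))) := fun i =>
      (hz i).2.continuousAt.tendsto.comp (hcoord i)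
    exact ((hFi i).sub ((Complex.continuous_conj.tendsto _).comp (hFi j))).div
      ((hcoord i).sub ((Complex.continuous_conj.tendsto _).comp (hcoord j)))
      (sub_conj_ne_zero (hz i).1 (hz j).1)
  have hgood : ∀ᶠ w in Filter.pi fun i => 𝓝[≠] (z i), ∀ i, w i ∈ G :=
    Filter.eventually_all.2 fun i => (tendsto_eval_pi _ i).eventually (hG _ (hz i).1)
  obtain ⟨w, hw1, hw2⟩ := ((hneg.eventually hlim).and hgood).exists
  exact hw1.le (hF n w hw2)

theorem mem_genNevanlinna {F f : ℂ → ℂ} {G : Set ℂ} {k : ℕ}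
    (hFm : MeromorphicOn F {z : ℂ | 0 < z.im})
    (hG : ∀ z : ℂ, 0 < z.im → ∀ᶠ w in 𝓝[≠] z, w ∈ G)
    (hF : ∀ (n : ℕ) (z : Fin n → ℂ), (∀ i, z i ∈ G) → NegRankLE (pickMatrix F z) k)
    (hf : AnalyticAt ℂ f 0) (hk : PickNegNearZero f k)
    (hFf : ∀ᶠ z in 𝓝[{z : ℂ | 0 < z.im}] 0, F z = f z) : F ∈ genNevanlinna k := by
  refine ⟨hFm, fun n z hz => pickNegSquares_le_of_dense hG hF hz, ?_⟩
  obtain ⟨n, z, hz, hle⟩ := hk.exists_le_pickNegSquares hf hFf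
  exact ⟨n, z, hz, le_antisymm (pickNegSquares_le_of_dense hG hF hz) hle⟩

theorem HasPickExtension.continuesInto {φ : ℂ → ℂ} {e : ℝ} {a b : ℕ}
    (h : HasPickExtension φ e a b) (hφ : AnalyticAt ℂ φ 0)
    (ha : PickNegNearZero (fun w => (e : ℂ) * φ w) a)
    (hb : PickNegNearZero (fun w => w * ((e : ℂ) * φ w)) b) :
    ContinuesInto (genStieltjes a b) fun z => (e : ℂ) * φ z := by
  obtain ⟨P, Q, G, hP, hQ, hQ1, hPQ, hGH, hG, hGQ, hneg⟩ := h
  have hFφ : ∀ᶠ z in 𝓝[{z : ℂ | 0 < z.im}] 0, (e : ℂ) * (P z / Q z) = e * φ z := by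
    filter_upwards [hPQ, hQ1.eventually_ne one_ne_zero] with z h1 h2
    rw [h1, mul_div_cancel_right₀ _ h2]
  have hm : MeromorphicOn (fun z => (e : ℂ) * (P z / Q z)) {z : ℂ | 0 < z.im} := fun z hz =>
    (MeromorphicAt.const _ z).mul ((hP z hz).meromorphicAt.div (hQ z hz).meromorphicAt)
  refine ⟨fun z => (e : ℂ) * (P z / Q z), ⟨?_, ?_⟩, hFφ⟩
  · exact mem_genNevanlinna hm hG (fun n z hz => (hneg n z hz).1) (analyticAt_const.mul hφ) ha hFφ
  · refine mem_genNevanlinna (fun z hz => (MeromorphicAt.id z).mul (hm z hz)) hG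
      (fun n z hz => (hneg n z hz).2) (analyticAt_id.mul (analyticAt_const.mul hφ)) hb ?_
    filter_upwards [hFφ] with z hz
    exact congrArg (z * ·) hz

end

/-! ### Sign bookkeeping and the resulting membership statements. -/

section

theorem exists_le_altNegCount {e : ℕ → ℝ} {p j : ℕ}
    (h : {i | i % 2 = p ∧ e (j + i + 1) < 0}.Infinite) (K : ℕ) : ∃ s, K ≤ altNegCount e p s j := by
  obtain ⟨t, ht, htK⟩ := h.exists_subset_card_eq K
  refine ⟨t.sup id + 1, ?_⟩
  rw [altNegCount, ← Finset.card_filter, ← htK]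
  refine Finset.card_le_card fun i hi => ?_
  rw [Finset.mem_filter, Finset.mem_range]
  exact ⟨Nat.lt_succ_of_le (Finset.le_sup (f := id) hi), ht hi⟩

theorem notMem_genNevanlinna {F f : ℂ → ℂ} (hf : AnalyticAt ℂ f 0)
    (hk : ∀ K, ∃ k, K ≤ k ∧ PickNegNearZero f k)
    (hFf : ∀ᶠ z in 𝓝[{z : ℂ | 0 < z.im}] 0, F z = f z) (κ : ℕ) : F ∉ genNevanlinna κ := by
  rintro ⟨-, hle, -⟩
  obtain ⟨k, hKk, hk⟩ := hk (κ + 1)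
  obtain ⟨n, z, hz, hkz⟩ := hk.exists_le_pickNegSquares hf hFf
  have := hle n z hz
  omega

/-- The partial products `ε α 0 ⋯ α (n - 1)`. -/
noncomputable def signedProd (α : ℕ → ℝ) (ε : ℝ) (n : ℕ) : ℝ := ε * ∏ i ∈ Finset.range n, α i

theorem signedProd_succ (α : ℕ → ℝ) (ε : ℝ) (n : ℕ) :
    signedProd α ε (n + 1) = signedProd α ε n * α n := by
  rw [signedProd, signedProd, Finset.prod_range_succ, mul_assoc]

theorem signedProd_zero (α : ℕ → ℝ) (ε : ℝ) : signedProd α ε 0 = ε := by simp [signedProd]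

theorem signedProd_ne_zero {α : ℕ → ℝ} (hα : ∀ n, α n ≠ 0) {ε : ℝ} (hε : ε ≠ 0) (n : ℕ) :
    signedProd α ε n ≠ 0 :=
  mul_ne_zero hε (Finset.prod_ne_zero_iff.2 fun i _ => hα i)

theorem range_prod_mul_Icc_prod (α : ℕ → ℝ) {m j : ℕ} (hj : j ≤ 2 * m + 1) :
    (∏ i ∈ Finset.range j, α i) * ∏ k ∈ Finset.Icc j (2 * m), α k =
      ∏ k ∈ Finset.Icc 0 (2 * m), α k := by
  have h1 : Finset.Icc j (2 * m) = Finset.Ico j (2 * m + 1) := by ext; simp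
  have h2 : Finset.Icc 0 (2 * m) = Finset.range (2 * m + 1) := by ext; simp
  rw [h1, h2, Finset.prod_range_mul_prod_Ico _ hj]

theorem Real.sign_mul_self_pos {x : ℝ} (hx : x ≠ 0) : 0 < Real.sign x * x := by
  rcases hx.lt_or_gt with h | h
  · rw [Real.sign_of_neg h]; linarith
  · rw [Real.sign_of_pos h]; linarith

theorem Real.sign_neg_iff {x : ℝ} : Real.sign x < 0 ↔ x < 0 := by
  rcases lt_trichotomy x 0 with h | rfl | h
  · simp [Real.sign_of_neg h, h]
  · simp
  · simp [Real.sign_of_pos h, h.le, not_lt.2 zero_le_one]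

/-- The product is `ε_0` times the full product of `α_0, …, α_{2m}`, of which `ε_0` is the sign; so
`e_j` has the sign `ε_j`. -/
theorem signedProd_mul_Icc_prod_pos {α : ℕ → ℝ} (hα : ∀ n, α n ≠ 0) {m j : ℕ}
    (hj : j ≤ 2 * m + 1) :
    0 < signedProd α (cfracSign α m 0) j * ∏ k ∈ Finset.Icc j (2 * m), α k := by
  rw [signedProd, mul_assoc, range_prod_mul_Icc_prod α hj, cfracSign]
  exact Real.sign_mul_self_pos (Finset.prod_ne_zero_iff.2 fun i _ => hα i)

theorem signedProd_neg_iff {α : ℕ → ℝ} (hα : ∀ n, α n ≠ 0) {m j : ℕ} (hj : j ≤ 2 * m + 1) :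
    signedProd α (cfracSign α m 0) j < 0 ↔ cfracSign α m j < 0 := by
  have h := signedProd_mul_Icc_prod_pos hα hj
  rw [cfracSign.eq_1 α m j, Real.sign_neg_iff]
  constructor
  · intro h1
    exact neg_of_mul_pos_right h h1.le
  · intro h1
    exact neg_of_mul_pos_left h h1.le

theorem signedProd_pos_of_lt {α : ℕ → ℝ} (hα : ∀ n, α n ≠ 0) {m : ℕ}
    (hpos : ∀ n, 2 * m < n → 0 < α n) {n : ℕ} (hn : 2 * m < n) :
    0 < signedProd α (cfracSign α m 0) n := by
  induction n, hn using Nat.le_induction with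
  | base =>
    have h := signedProd_mul_Icc_prod_pos hα (le_refl (2 * m + 1))
    simpa using h
  | succ n hn ih =>
    rw [signedProd_succ]
    exact mul_pos ih (hpos n hn)

theorem sum_range_two_mul_odd (f : ℕ → Prop) [DecidablePred f] (m : ℕ) :
    (∑ i ∈ Finset.range (2 * m), if i % 2 = 1 ∧ f i then 1 else 0) =
      ∑ i ∈ Finset.range m, if f (2 * i + 1) then 1 else 0 := by
  induction m with
  | zero => simp
  | succ m ih =>
    rw [show 2 * (m + 1) = 2 * m + 1 + 1 by ring, Finset.sum_range_succ, Finset.sum_range_succ,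
      Finset.sum_range_succ, ih]
    simp [Nat.add_mod]

theorem sum_range_two_mul_even (f : ℕ → Prop) [DecidablePred f] (m : ℕ) :
    (∑ i ∈ Finset.range (2 * m), if i % 2 = 0 ∧ f i then 1 else 0) =
      ∑ i ∈ Finset.range m, if f (2 * i) then 1 else 0 := by
  induction m with
  | zero => simp
  | succ m ih =>
    rw [show 2 * (m + 1) = 2 * m + 1 + 1 by ring, Finset.sum_range_succ, Finset.sum_range_succ,
      Finset.sum_range_succ, ih]
    simp [Nat.add_mod]

theorem altNegCount_one_eq_cfracKappa {α : ℕ → ℝ} (hα : ∀ n, α n ≠ 0) (m : ℕ) :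
    altNegCount (signedProd α (cfracSign α m 0)) 1 (2 * m + 1) 0 = cfracKappa α m := by
  -- The last of the `2m + 1` indices is `2m`, which has the wrong parity here; in the count for `λ`
  -- it has the right one, but `e_{2m+1} > 0`.
  rw [altNegCount, Finset.sum_range_succ, cfracKappa, Finset.card_filter,
    sum_range_two_mul_odd (fun i => signedProd α (cfracSign α m 0) (0 + i + 1) < 0) m]
  simp only [Nat.mul_mod_right, zero_ne_one, false_and, if_false, add_zero]
  refine Finset.sum_congr rfl fun i hi => if_congr ?_ rfl rfl
  rw [Finset.mem_range] at hi
  rw [show 0 + (2 * i + 1) + 1 = 2 * i + 2 by ring]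
  exact signedProd_neg_iff hα (by omega)

theorem altNegCount_zero_eq_cfracLambda {α : ℕ → ℝ} (hα : ∀ n, α n ≠ 0) {m : ℕ}
    (hpos : ∀ n, 2 * m < n → 0 < α n) :
    altNegCount (signedProd α (cfracSign α m 0)) 0 (2 * m + 1) 0 = cfracLambda α m := by
  rw [altNegCount, Finset.sum_range_succ, cfracLambda, Finset.card_filter,
    sum_range_two_mul_even (fun i => signedProd α (cfracSign α m 0) (0 + i + 1) < 0) m,
    if_neg (fun h => absurd h.2 (not_lt.2 (signedProd_pos_of_lt hα hpos (by omega)).le)), add_zero]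
  refine Finset.sum_congr rfl fun i hi => if_congr ?_ rfl rfl
  rw [Finset.mem_range] at hi
  rw [show 0 + 2 * i + 1 = 2 * i + 1 by ring]
  exact signedProd_neg_iff hα (by omega)

theorem analyticAt_cfracTail {α : ℕ → ℝ} {C : ℝ} (hC : ∀ n, |α n| ≤ C) (n : ℕ) :
    AnalyticAt ℂ (cfracTail α n) 0 :=
  analyticOnNhd_cfracTail hC n 0 (mem_of_mem_nhds (cfracDisc_mem_nhds C))

theorem continuesInto_genStieltjes {α : ℕ → ℝ} {C : ℝ} (hα : ∀ n, α n ≠ 0)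
    (hC : ∀ n, |α n| ≤ C) {m : ℕ} (hpos : ∀ n, 2 * m < n → 0 < α n) :
    ContinuesInto (genStieltjes (cfracKappa α m) (cfracLambda α m))
      (fun z => (cfracSign α m 0 : ℂ) * cfrac α z) := by
  have he := signedProd_succ α (cfracSign α m 0)
  obtain ⟨h1, h2⟩ := pickNegNearZero_cfracTail hα hC he (2 * m + 1) 0
  have h3 := hasPickExtension_cfracTail hα hC he (M := 2 * m + 1) hpos
    (signedProd_pos_of_lt hα hpos (by omega)).le (2 * m + 1) 0 (by omega)
  have h4 := h3.continuesInto (analyticAt_cfracTail hC 0) h1 h2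
  rwa [altNegCount_one_eq_cfracKappa hα, altNegCount_zero_eq_cfracLambda hα hpos,
    signedProd_zero] at h4

theorem not_continuesInto_genNevanlinnaUnion {α : ℕ → ℝ} {C : ℝ} (hα : ∀ n, α n ≠ 0)
    (hC : ∀ n, |α n| ≤ C) {ε : ℝ}
    (h : {i | i % 2 = 1 ∧ signedProd α ε (0 + i + 1) < 0}.Infinite) :
    ¬ ContinuesInto genNevanlinnaUnion (fun z => (ε : ℂ) * cfrac α z) := by
  rintro ⟨F, hF, hFφ⟩
  obtain ⟨κ, hκ⟩ := Set.mem_iUnion.1 hF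
  refine notMem_genNevanlinna (analyticAt_const.mul (analyticAt_cfracTail hC 0)) (fun K => ?_)
    hFφ κ hκ
  obtain ⟨s, hs⟩ := exists_le_altNegCount h K
  have := (pickNegNearZero_cfracTail hα hC (signedProd_succ α ε) s 0).1
  rw [signedProd_zero] at this
  exact ⟨_, hs, this⟩

theorem not_continuesInto_genStieltjesUnion {α : ℕ → ℝ} {C : ℝ} (hα : ∀ n, α n ≠ 0)
    (hC : ∀ n, |α n| ≤ C) {ε : ℝ}
    (h : {i | signedProd α ε (0 + i + 1) < 0}.Infinite) :
    ¬ ContinuesInto genStieltjesUnion (fun z => (ε : ℂ) * cfrac α z) := by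
  rintro ⟨F, hF, hFφ⟩
  obtain ⟨κ, hF⟩ := Set.mem_iUnion.1 hF
  obtain ⟨l, hF⟩ := Set.mem_iUnion.1 hF
  have hsub : {i | signedProd α ε (0 + i + 1) < 0} ⊆
      {i | i % 2 = 1 ∧ signedProd α ε (0 + i + 1) < 0} ∪
        {i | i % 2 = 0 ∧ signedProd α ε (0 + i + 1) < 0} := by
    intro i hi
    rcases Nat.mod_two_eq_zero_or_one i with h0 | h1
    · exact Or.inr ⟨h0, hi⟩
    · exact Or.inl ⟨h1, hi⟩
  rcases Set.infinite_union.1 (h.mono hsub) with h | h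
  · exact not_continuesInto_genNevanlinnaUnion hα hC h
      ⟨F, Set.mem_iUnion.2 ⟨κ, hF.1⟩, hFφ⟩
  · refine notMem_genNevanlinna (f := fun z => z * ((ε : ℂ) * cfracTail α 0 z))
      (analyticAt_id.mul (analyticAt_const.mul (analyticAt_cfracTail hC 0)))
      (fun K => ?_) ?_ l hF.2
    · obtain ⟨s, hs⟩ := exists_le_altNegCount h K
      have := (pickNegNearZero_cfracTail hα hC (signedProd_succ α ε) s 0).2
      rw [signedProd_zero] at this
      exact ⟨_, hs, this⟩
    · filter_upwards [hFφ] with z hz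
      exact congrArg (z * ·) hz

/-- If the products were eventually positive, the next negative coefficient would make one negative.
-/
theorem infinite_signedProd_neg {α : ℕ → ℝ} (hα : ∀ n, α n ≠ 0) {ε : ℝ} (hε : ε ≠ 0)
    (h : {n | α n < 0}.Infinite) : {i | signedProd α ε (0 + i + 1) < 0}.Infinite := by
  intro hfin
  obtain ⟨N, hN⟩ := hfin.bddAbove
  have hpos : ∀ n, N + 1 < n → 0 < signedProd α ε n := by
    intro n hn
    refine lt_of_le_of_ne (not_lt.1 fun hneg => ?_) (signedProd_ne_zero hα hε n).symm
    have := hN (show n - 1 ∈ {i | signedProd α ε (0 + i + 1) < 0} by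
      rw [Set.mem_ofPred_eq, show 0 + (n - 1) + 1 = n by omega]
      exact hneg)
    omega
  obtain ⟨n, hn, hNn⟩ := h.exists_gt (N + 1)
  have h1 := hpos n hNn
  have h2 := hpos (n + 1) (by omega)
  rw [signedProd_succ] at h2
  exact absurd (mul_neg_of_pos_of_neg h1 hn) (not_lt.2 h2.le)

theorem Real.sign_mul (x y : ℝ) : Real.sign (x * y) = Real.sign x * Real.sign y := by
  rcases lt_trichotomy x 0 with hx | rfl | hx <;> rcases lt_trichotomy y 0 with hy | rfl | hy <;>
    simp [Real.sign_of_neg, Real.sign_of_pos, mul_pos_of_neg_of_neg, mul_neg_of_neg_of_pos,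
      mul_neg_of_pos_of_neg, *]

theorem Real.sign_prod (s : Finset ℕ) (f : ℕ → ℝ) :
    Real.sign (∏ i ∈ s, f i) = ∏ i ∈ s, Real.sign (f i) :=
  map_prod (⟨⟨Real.sign, Real.sign_one⟩, Real.sign_mul⟩ : ℝ →* ℝ) f s

theorem eventually_prod_sign_eq_cfracSign {α : ℕ → ℝ} {m : ℕ} (hpos : ∀ n, 2 * m < n → 0 < α n)
    (j : ℕ) : ∀ᶠ M in atTop, ∏ k ∈ Finset.Icc j M, Real.sign (α k) = cfracSign α m j := by
  filter_upwards [eventually_ge_atTop (2 * m)] with M hM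
  rw [cfracSign, Real.sign_prod]
  refine (Finset.prod_subset (Finset.Icc_subset_Icc_right hM) fun k hk hk' => ?_).symm
  rw [Finset.mem_Icc] at hk hk'
  exact Real.sign_of_pos (hpos k (by omega))

theorem cfracSign_eq_one_or {α : ℕ → ℝ} (hα : ∀ n, α n ≠ 0) (m j : ℕ) :
    cfracSign α m j = 1 ∨ cfracSign α m j = -1 :=
  (Real.sign_apply_eq_of_ne_zero _ (Finset.prod_ne_zero_iff.2 fun i _ => hα i)).symm

end

theorem mainTheorem6 (α : ℕ → ℝ) (hα : ∀ n, α n ≠ 0)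
    (hbdd : BddAbove (Set.range fun n => |α n|)) :
    -- near the origin the continued fraction converges uniformly, to an analytic function
    (AnalyticAt ℂ (cfrac α) 0 ∧
      ∃ U ∈ 𝓝 (0 : ℂ),
        TendstoUniformlyOn (fun N z => cfracApprox α N 0 z) (cfrac α) atTop U) ∧
    -- the case of eventually positive coefficients
    (∀ m : ℕ, 1 ≤ m → (∀ n, 2 * m < n → 0 < α n) →
      (∀ j, ∀ᶠ M in atTop,
        ∏ k ∈ Finset.Icc j M, Real.sign (α k) = cfracSign α m j) ∧
      ContinuesInto (genStieltjes (cfracKappa α m) (cfracLambda α m))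
        (fun z => (cfracSign α m 0 : ℂ) * cfrac α z) ∧
      ¬ ContinuesInto genNevanlinnaUnion
        (fun z => -(cfracSign α m 0 : ℂ) * cfrac α z)) ∧
    -- the criterion for both signs to fail
    ((∀ ε : ℝ, ε = 1 ∨ ε = -1 →
        ¬ ContinuesInto genStieltjesUnion (fun z => (ε : ℂ) * cfrac α z)) ↔
      {n | α n < 0}.Infinite) := by
  obtain ⟨C, hC⟩ := hbdd
  replace hC : ∀ n, |α n| ≤ C := fun n => hC ⟨n, rfl⟩
  refine ⟨⟨analyticAt_cfracTail hC 0, _, cfracDisc_mem_nhds C, tendstoUniformlyOn_cfracTail hC 0⟩,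
    fun m _ hpos => ⟨eventually_prod_sign_eq_cfracSign hpos,
      continuesInto_genStieltjes hα hC hpos, ?_⟩, fun h => ?_, fun h ε hε => ?_⟩
  · rw [← Complex.ofReal_neg]
    -- Reversing `ε` negates every `e_n`, so `e_n < 0` for all `n > 2m`; the odd indices `2(i + m) +
    -- 1` select the even `n = 2(i + m) + 2` that count for `φ`.
    refine not_continuesInto_genNevanlinnaUnion hα hC
      (Set.infinite_of_injective_forall_mem (f := fun i : ℕ => 2 * (i + m) + 1)
        (fun a b hab => by simpa using hab) fun i => ⟨by omega, ?_⟩)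
    have := signedProd_pos_of_lt hα hpos (n := 0 + (2 * (i + m) + 1) + 1) (by omega)
    simp only [signedProd] at this ⊢
    linarith
  · by_contra hfin
    obtain ⟨N, hN⟩ := (Set.not_infinite.1 hfin).bddAbove
    -- The choice `m = N + 1` puts `2m` beyond every negative coefficient, so membership holds for
    -- `ε = ε_0`, one of the two signs.
    have hpos : ∀ n, 2 * (N + 1) < n → 0 < α n := fun n hn =>
      lt_of_le_of_ne (not_lt.1 fun hneg => by have := hN hneg; omega) (hα n).symm
    obtain ⟨F, hF, hFφ⟩ := continuesInto_genStieltjes hα hC hpos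
    exact h _ (cfracSign_eq_one_or hα (N + 1) 0)
      ⟨F, Set.mem_iUnion.2 ⟨_, Set.mem_iUnion.2 ⟨_, hF⟩⟩, hFφ⟩
  · exact not_continuesInto_genStieltjesUnion hα hC (infinite_signedProd_neg hα
      (by rcases hε with rfl | rfl <;> norm_num) h)
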